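/- **Corollary (computational complexity).** Consider an episodic POMDP with horizon $H\ge 1$, finite action set $\mathcal A$ with $|\mathcal A|=A\ge 1$, arbitrary latent state space $\mathcal S$ and observation space $\mathcal O$, fixed initial latent state $s_0$, deterministic latent transitions $s_{h+1}=p_h(s_h,a_h)$, emission laws $\mathbb O_h(\cdot\mid s)$ on $\mathcal O$, and reward laws $\mathbb Y_h(\cdot\mid s,a)$ on $[0,1]$ with means $r_h(s,a)$. Let $Q^\star_h(s,a)=r_h(s,a)+\max_{a'}Q^\star_{h+1}(p_h(s,a),a')$ with $Q^\star_H=0$, and $V^\star_h(s)=\max_a Q^\star_h(s,a)$. Let $\psi:\mathcal O\to\mathbb R^d$ be measurable with $\|\psi(o)\|\le 1$ for all $o$, and let $\phi:\mathcal S\to\mathbb R^{d_s}$, $d_s\geq 1$. Assume, for all $0\le h<H$: 1. there is a matrix $G_h\in\mathbb R^{d\times d_s}$ with a left inverse such that $\mathbb E_{o\sim\mathbb O_h(\cdot\mid s)}[\psi(o)]=G_h\phi(s)$ for all $s$; 2. for each $a$ there is $w^\star_{a;h}\in\mathbb R^{d_s}$ with $\|w^\star_{a;h}\|\le W$ and $Q^\star_h(s,a)=\langle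 w^\star_{a;h},\phi(s)\rangle$ for all $s$; 3. whenever $V^\star_h(s)-Q^\star_h(s,a)>0$, it is at least $\Delta$, where $\Delta>0$. Let $\Theta=W/\min_h\eta(G_h)$, where $\eta$ is the smallest singular value, and let $0<\delta<1$. For a sequence of actions $a_{0:h-1}$ let $s_h(a_{0:h-1})$ be the latent state it leads to from $s_0$. *The algorithm.* It has parameters $M\in\mathbb N_{>0}$, $\varepsilon>0$, $\lambda>0$, and keeps initially empty datasets $\mathcal D_h$ of vectors in $\mathbb R^d$ and $\mathcal D_{a;h}$ of pairs in $\mathbb R^d\times\mathbb R$. Put $\Sigma_h=\lambda I+\sum_{x\in\mathcal D_h}xx^\top$ and $\hat\theta_{a;h}=\Sigma_h^{-1}\sum_{(x,y)\in\mathcal D_{a;h}}y\,x$. Call $x$ *covered* at step $h$ if $x^\top\Sigma_h^{-1}x\le\varepsilon^2$. The estimate $\hat x_h(a_{0:h-1})$ is the mean of $\psi(o_h)$ over $M$ fresh episodes in which $a_{0:h-1}$ is played, and $\hat r_h(a_{0:h-1},a)$ is the mean reward at step $h$ over $M$ fresh episodes in which $a_{0:h-1},a$ is played. - To *explore* $(a_{0:h-1},x)$: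 for each $a'\in\mathcal A$ compute $y_{a'}=\hat r_h(a_{0:h-1},a')+\mathrm{ComputeV}(h+1;a_{0:h-1},a')$ and add $(x,y_{a'})$ to $\mathcal D_{a';h}$; then add $x$ to $\mathcal D_h$. - $\mathrm{ComputeV}(h;a_{0:h-1})$: if $h=H$, return $0$. If $h=H-1$, return $\max_a\hat r_h(a_{0:h-1},a)$. Otherwise compute $x=\hat x_h(a_{0:h-1})$. If $x$ is covered, let $a_h\in\arg\max_a\langle\hat\theta_{a;h},x\rangle$ and return $\hat r_h(a_{0:h-1},a_h)+\mathrm{ComputeV}(h+1;a_{0:h-1},a_h)$. If not, explore $(a_{0:h-1},x)$ and return $\max_a y_a$. - Main loop: repeat the following. For $h=0,\dots,H-1$ compute $x_h=\hat x_h(a_{0:h-1})$ and $a_h\in\arg\max_a\langle\hat\theta_{a;h},x_h\rangle$. If every $x_h$ is covered at step $h$, output $a_{0:H-1}$ and stop. Otherwise take the smallest $h$ such that $x_h$ is not covered and explore $(a_{0:h-1},x_h)$. *Cost.* Each operation $+,-,\times,\div$ on real numbers, each comparison of two real numbers, each start of an episode, each sampling of an observation, each played action (with the sampling of its reward), and each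 reading of one coordinate of a feature vector $\psi(o)$ costs one unit. Matrices $\Sigma_h^{-1}$ are computed from these operations by rank-one updates. *Claim.* There is a universal polynomial $P$ in six variables such that, for all $H,d,A,\Theta,\delta,\Delta$, the parameters $M,\varepsilon,\lambda$ can be chosen as functions of $(H,d,A,\Theta,\delta,\Delta)$ only so that, for every POMDP and features as above, the algorithm always terminates, at total cost at most $$P\bigl(H,d,\Theta,\ln(1/\delta),1/\Delta,A\bigr),$$ and, with probability at least $1-\delta$, its output is an action sequence that maximizes the expected total reward $\mathbb E[\sum_{h<H}r_h]$ among all (history-dependent, possibly randomized) policies. -/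

import Mathlib

open MeasureTheory

noncomputable section

namespace EQDP

/-! ### The model -/

/-- An episodic POMDP with `A` actions whose latent transitions are deterministic (`next h s a` is
the point at which the Dirac transition law from `(s, a)` at step `h` sits), with arbitrary latent
and observation spaces, stochastic emissions and stochastic rewards in `[0, 1]`. Steps are indexed
by `ℕ`; with horizon `H` only the steps `h < H` are ever used. -/
structure DetPOMDP (S : Type*) (O : Type*) [MeasurableSpace O] (A : ℕ) where
  /-- the initial latent state -/
  init : S
  /-- the deterministic latent transition -/
  next : ℕ → S → Fin A → S
  /-- the law of the observation emitted at step `h` in a latent state -/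
  emission : ℕ → S → Measure O
  /-- the law of the reward at step `h` in a latent state under an action -/
  reward : ℕ → S → Fin A → Measure ℝ
  emission_prob : ∀ h s, IsProbabilityMeasure (emission h s)
  reward_prob : ∀ h s a, IsProbabilityMeasure (reward h s a)
  reward_mem : ∀ h s a, ∀ᵐ x ∂(reward h s a), x ∈ Set.Icc (0 : ℝ) 1

attribute [instance] DetPOMDP.emission_prob DetPOMDP.reward_prob

namespace DetPOMDP

variable {S : Type*} {O : Type*} [MeasurableSpace O] {A : ℕ} (𝓜 : DetPOMDP S O A)

/-- The mean reward `r_h(s, a)`. -/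
def meanReward (h : ℕ) (s : S) (a : Fin A) : ℝ := ∫ x, x ∂(𝓜.reward h s a)

/-- The latent state reached from `s` at step `h` by playing a list of actions. -/
def latentFrom : ℕ → S → List (Fin A) → S
  | _, s, [] => s
  | h, s, a :: l => latentFrom (h + 1) (𝓜.next h s a) l

/-- The latent state `s_h(a_{0:h-1})` reached from the initial state, with `h` the length of the
list of actions. -/
def latent (l : List (Fin A)) : S := 𝓜.latentFrom 0 𝓜.init l

/-- The optimal latent value at step `h` with `k` steps to go, by backward recursion. -/
def optValue [NeZero A] : ℕ → ℕ → S → ℝ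
  | 0, _, _ => 0
  | k + 1, h, s => Finset.univ.sup' Finset.univ_nonempty
      fun a : Fin A => 𝓜.meanReward h s a + optValue k (h + 1) (𝓜.next h s a)

/-- `V⋆_h(s)` for horizon `H`. -/
def Vstar [NeZero A] (H h : ℕ) (s : S) : ℝ := 𝓜.optValue (H - h) h s

/-- `Q⋆_h(s, a) = r_h(s, a) + V⋆_{h+1}(p_h(s, a))` for horizon `H` and `h < H`. -/
def Qstar [NeZero A] (H h : ℕ) (s : S) (a : Fin A) : ℝ :=
  𝓜.meanReward h s a + 𝓜.Vstar H (h + 1) (𝓜.next h s a)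

/-- A (possibly randomized) policy: from the past observations, actions and rewards, oldest first,
and the current observation, a distribution over actions. -/
abbrev Policy (O : Type*) (A : ℕ) := List (O × Fin A × ℝ) → O → PMF (Fin A)

/-- The expected total reward collected by a policy during `k` more steps, starting at step `h` in
latent state `s` with a given history. -/
def valueFrom (π : Policy O A) : ℕ → ℕ → S → List (O × Fin A × ℝ) → ℝ
  | 0, _, _, _ => 0
  | k + 1, h, s, hist =>
      ∫ o, ∑ a : Fin A, (π hist o a).toReal *
        ∫ x, (x + valueFrom π k (h + 1) (𝓜.next h s a) (hist ++ [(o, a, x)]))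
          ∂(𝓜.reward h s a) ∂(𝓜.emission h s)

/-- The expected total reward `𝔼_π[∑_h r_h]` of a policy in an episode of `H` steps. -/
def value (H : ℕ) (π : Policy O A) : ℝ := 𝓜.valueFrom π H 0 𝓜.init []

/-- The policy that plays a fixed sequence of actions, whatever it observes. -/
def openLoop [NeZero A] (l : List (Fin A)) : Policy O A :=
  fun hist _ => PMF.pure (l.getD hist.length 0)

/-- `l` is a sequence of `H` actions which is a globally optimal policy: no history-dependent
policy has larger expected total reward. -/
def IsOptimalSeq [NeZero A] (H : ℕ) (l : List (Fin A)) : Prop :=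
  l.length = H ∧ ∀ π : Policy O A, 𝓜.value H π ≤ 𝓜.value H (openLoop l)

/-- `G_h` is a left-invertible linear conditional mean embedding of the emission law, for each
`h < H`, with state feature `φ` and observation feature `ψ`. -/
def IsMeanEmbedding (H : ℕ) {d dₛ : ℕ} (ψ : O → EuclideanSpace ℝ (Fin d))
    (φ : S → EuclideanSpace ℝ (Fin dₛ)) (G : Fin H → Matrix (Fin d) (Fin dₛ) ℝ) : Prop :=
  ∀ h : Fin H, (∀ s, ∫ o, ψ o ∂(𝓜.emission h s) = Matrix.toEuclideanLin (G h) (φ s)) ∧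
    ∃ L : Matrix (Fin dₛ) (Fin d) ℝ, L * G h = 1

/-- `Q⋆` is linear in the state feature, with weights of norm at most `W`. -/
def LinearQstar [NeZero A] (H : ℕ) {dₛ : ℕ} (φ : S → EuclideanSpace ℝ (Fin dₛ)) (W : ℝ) : Prop :=
  ∀ h < H, ∀ a : Fin A, ∃ w : EuclideanSpace ℝ (Fin dₛ), ‖w‖ ≤ W ∧
    ∀ s, 𝓜.Qstar H h s a = inner ℝ w (φ s)

/-- Every positive gap `V⋆_h(s) - Q⋆_h(s, a)` is at least `Δ`. -/
def HasGap [NeZero A] (H : ℕ) (Δ : ℝ) : Prop :=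
  ∀ h < H, ∀ (s : S) (a : Fin A), 0 < 𝓜.Vstar H h s - 𝓜.Qstar H h s a →
    Δ ≤ 𝓜.Vstar H h s - 𝓜.Qstar H h s a

end DetPOMDP

/-- The smallest singular value of a `d × dₛ` matrix with `0 < dₛ ≤ d`. -/
def minSingularValue {d dₛ : ℕ} (G : Matrix (Fin d) (Fin dₛ) ℝ) : ℝ :=
  (Matrix.toEuclideanLin G).singularValues (dₛ - 1)

/-! ### The machine

A program is a state transformer. Its only access to real arithmetic is through `add`, `sub`,
`mul`, `div`, `le`, and its only access to the POMDP is through `reset`, `observe`, `act`; each of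
these is charged to the counter `steps`. -/

/-- A vector as an array of real numbers. -/
abbrev Vec (d : ℕ) := Fin d → ℝ

structure Machine (A d : ℕ) where
  /-- number of elementary operations performed so far -/
  steps : ℕ
  /-- number of the current episode -/
  episode : ℕ
  /-- the actions played in the current episode -/
  played : List (Fin A)
  /-- the datasets `𝒟_h`, most recent entry first -/
  feats : ℕ → List (Vec d)
  /-- the datasets `𝒟_{a;h}`, most recent entry first -/
  pairs : Fin A → ℕ → List (Vec d × ℝ)

/-- The machine at the start, with empty datasets. -/
def Machine.start (A d : ℕ) : Machine A d := ⟨0, 0, [], fun _ => [], fun _ _ => []⟩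

abbrev Prog (A d : ℕ) := StateM (Machine A d)

/-- What the environment answers in each episode: the feature `ψ(o_h)` of the observation after
actions `a_{0:h-1}`, and the reward after actions `a_{0:h-1}` and the further action `a_h`. -/
structure Env (A d : ℕ) where
  feat : ℕ → List (Fin A) → Vec d
  rew : ℕ → List (Fin A) → Fin A → ℝ

section Programs

variable {A d : ℕ}

/-- Charge `n` elementary operations. -/
def charge (n : ℕ) : Prog A d Unit := modify fun m => { m with steps := m.steps + n }

def add (x y : ℝ) : Prog A d ℝ := do charge 1; pure (x + y)
def sub (x y : ℝ) : Prog A d ℝ := do charge 1; pure (x - y)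
def mul (x y : ℝ) : Prog A d ℝ := do charge 1; pure (x * y)
def div (x y : ℝ) : Prog A d ℝ := do charge 1; pure (x / y)
def le (x y : ℝ) : Prog A d Bool := do charge 1; pure (decide (x ≤ y))

/-- Start a new episode. -/
def reset : Prog A d Unit := do
  charge 1
  modify fun m => { m with episode := m.episode + 1, played := [] }

/-- Sample the current observation and read the `d` coordinates of its feature. -/
def observe (E : Env A d) : Prog A d (Vec d) := do
  charge (1 + d)
  let m ← get
  pure (E.feat m.episode m.played)

/-- Play an action and sample its reward. -/
def act (E : Env A d) (a : Fin A) : Prog A d ℝ := do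
  charge 1
  let m ← get
  set { m with played := m.played ++ [a] }
  pure (E.rew m.episode m.played a)

/-- `𝒟_h := 𝒟_h + {x}` -/
def storeFeat (h : ℕ) (x : Vec d) : Prog A d Unit :=
  modify fun m => { m with feats := Function.update m.feats h (x :: m.feats h) }

/-- `𝒟_{a;h} := 𝒟_{a;h} + {(x, y)}` -/
def storePair (a : Fin A) (h : ℕ) (x : Vec d) (y : ℝ) : Prog A d Unit :=
  modify fun m => { m with
    pairs := Function.update m.pairs a
      (Function.update (m.pairs a) h ((x, y) :: m.pairs a h)) }

/-- Run a program for each index in turn and collect the results. -/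
def tabulate {α : Type} : (n : ℕ) → (Fin n → Prog A d α) → Prog A d (Fin n → α)
  | 0, _ => pure Fin.elim0
  | n + 1, f => do
      let x ← f 0
      let xs ← tabulate n fun i => f i.succ
      pure (Fin.cons x xs)

/-- Run a program for each index in turn and add up the results. -/
def sumUp : (n : ℕ) → (Fin n → Prog A d ℝ) → Prog A d ℝ
  | 0, _ => pure 0
  | n + 1, f => do
      let s ← sumUp n fun i => f i.castSucc
      let x ← f (Fin.last n)
      add s x

/-! Linear algebra -/

def vecAdd (x y : Vec d) : Prog A d (Vec d) := tabulate d fun i => add (x i) (y i)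

def dot (x y : Vec d) : Prog A d ℝ := sumUp d fun i => mul (x i) (y i)

def matVec (P : Fin d → Vec d) (x : Vec d) : Prog A d (Vec d) := tabulate d fun i => dot (P i) x

/-- `Σ⁻¹` for `Σ = ∑ x xᵀ + lam I`, the sum being over a list of vectors, computed by rank-one
updates `(Σ + x xᵀ)⁻¹ = Σ⁻¹ - u uᵀ / (1 + xᵀ u)` with `u = Σ⁻¹ x`
(see `invGram_eq` below). -/
def invGram (lam : ℝ) : List (Vec d) → Prog A d (Fin d → Vec d)
  | [] => tabulate d fun i => tabulate d fun j => if i = j then div 1 lam else pure 0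
  | x :: l => do
      let P ← invGram lam l
      let u ← matVec P x
      let s ← dot x u
      let c ← add 1 s
      tabulate d fun i => tabulate d fun j => do
        let p ← mul (u i) (u j)
        let q ← div p c
        sub (P i j) q

/-- `∑ x y` over a list of pairs `(x, y)`. -/
def moment : List (Vec d × ℝ) → Prog A d (Vec d)
  | [] => pure 0
  | z :: l => do
      let s ← moment l
      let t ← tabulate d fun i => mul (z.1 i) z.2
      vecAdd s t

/-- The index of a largest entry. -/
def argmaxFrom (v : Fin A → ℝ) : List (Fin A) → Fin A → Prog A d (Fin A)
  | [], b => pure b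
  | a :: l, b => do
      if ← le (v a) (v b) then argmaxFrom v l b else argmaxFrom v l a

def argmax [NeZero A] (v : Fin A → ℝ) : Prog A d (Fin A) := argmaxFrom v (List.finRange A) 0

/-! Sampling -/

/-- Play a list of actions in the current episode. -/
def execute (E : Env A d) : List (Fin A) → Prog A d Unit
  | [] => pure ()
  | a :: l => do
      let _ ← observe E
      let _ ← act E a
      execute E l

/-- The sum of the features of `n` observations after `l`, each in a fresh episode. -/
def featureSum (E : Env A d) (l : List (Fin A)) : ℕ → Prog A d (Vec d)
  | 0 => pure 0
  | n + 1 => do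
      let s ← featureSum E l n
      reset
      execute E l
      let x ← observe E
      vecAdd s x

/-- The estimated feature `x̂_h(a_{0:h-1})` from `M` samples. -/
def featureMean (E : Env A d) (M : ℕ) (l : List (Fin A)) : Prog A d (Vec d) := do
  let s ← featureSum E l M
  tabulate d fun i => div (s i) M

/-- The sum of the rewards of `n` plays of action `a` after `l`, each in a fresh episode. -/
def rewardSum (E : Env A d) (l : List (Fin A)) (a : Fin A) : ℕ → Prog A d ℝ
  | 0 => pure 0
  | n + 1 => do
      let s ← rewardSum E l a n
      reset
      execute E l
      let _ ← observe E
      let x ← act E a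
      add s x

/-- The estimated reward `r̂_h(s_h(a_{0:h-1}), a)` from `M` samples. -/
def rewardMean (E : Env A d) (M : ℕ) (l : List (Fin A)) (a : Fin A) : Prog A d ℝ := do
  let s ← rewardSum E l a M
  div s M

/-! The algorithm -/

/-- The input parameters of the algorithm. -/
structure Params where
  M : ℕ
  ε : ℝ
  lam : ℝ

/-- Whether `‖x‖_{Σ_h⁻¹(𝒟_h)} ≤ ε`, tested as `xᵀ Σ_h⁻¹ x ≤ ε²`. -/
def covered (p : Params) (h : ℕ) (x : Vec d) : Prog A d Bool := do
  let m ← get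
  let P ← invGram p.lam (m.feats h)
  let u ← matVec P x
  let q ← dot x u
  let e ← mul p.ε p.ε
  le q e

/-- `argmax_a ⟨θ̂_{a;h}(𝒟_{a;h}), x⟩` for the ridge regression estimates `θ̂_{a;h}`. -/
def greedy [NeZero A] (p : Params) (h : ℕ) (x : Vec d) : Prog A d (Fin A) := do
  let m ← get
  let v ← tabulate A fun a => do
    let P ← invGram p.lam (m.feats h)
    let b ← moment (m.pairs a h)
    let θ ← matVec P b
    dot θ x
  argmax v

/-- The treatment of a feature `x = x̂_h(l)` that is not covered: try each action after `l`, use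
`V` to estimate the value after it, store the results, and return the estimates `y_{a;h}`. -/
def explore (E : Env A d) (p : Params) (V : List (Fin A) → Prog A d ℝ) (l : List (Fin A))
    (x : Vec d) : Prog A d (Fin A → ℝ) := do
  let y ← tabulate A fun a => do
    let r ← rewardMean E p.M l a
    let v ← V (l ++ [a])
    let y ← add r v
    storePair a l.length x y
    pure y
  storeFeat l.length x
  pure y

/-- The subroutine `Compute-V⋆(h; a_{0:h-1})`. The first argument is the number `H - h` of steps
to go; at `h = H` the value is zero. -/
def computeV [NeZero A] (E : Env A d) (p : Params) : ℕ → List (Fin A) → Prog A d ℝ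
  | 0, _ => pure 0
  | 1, l => do
      let r ← tabulate A fun a => rewardMean E p.M l a
      let b ← argmax r
      pure (r b)
  | k + 2, l => do
      let x ← featureMean E p.M l
      if ← covered p l.length x then
        let a ← greedy p l.length x
        let r ← rewardMean E p.M l a
        let v ← computeV E p (k + 1) (l ++ [a])
        add r v
      else
        let y ← explore E p (fun l' => computeV E p (k + 1) l') l x
        let b ← argmax y
        pure (y b)

/-- The for loop of the main program: starting after the actions `l`, estimate the feature and
choose the greedy action for `k` more steps. Returns all actions and the new features. -/
def forward [NeZero A] (E : Env A d) (p : Params) :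
    ℕ → List (Fin A) → Prog A d (List (Fin A) × List (Vec d))
  | 0, l => pure (l, [])
  | k + 1, l => do
      let x ← featureMean E p.M l
      let a ← greedy p l.length x
      let z ← forward E p k (l ++ [a])
      pure (z.1, x :: z.2)

/-- The smallest step whose feature is not covered, with that feature, the features listed being
those of the steps `h, h + 1, …`. -/
def firstUncovered (p : Params) : ℕ → List (Vec d) → Prog A d (Option (ℕ × Vec d))
  | _, [] => pure none
  | h, x :: xs => do
      if ← covered p h x then firstUncovered p (h + 1) xs else pure (some (h, x))

/-- One round of the main while loop; it returns `some` when the algorithm terminates. -/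
def round [NeZero A] (E : Env A d) (p : Params) (H : ℕ) : Prog A d (Option (List (Fin A))) := do
  let z ← forward E p H []
  let u ← firstUncovered p 0 z.2
  match u with
  | none => pure (some z.1)
  | some (h, x) => do
      let _ ← explore E p (computeV E p (H - (h + 1))) (z.1.take h) x
      pure none

/-- The main while loop, cut off after `n` rounds. -/
def rounds [NeZero A] (E : Env A d) (p : Params) (H : ℕ) :
    ℕ → Prog A d (Option (List (Fin A)))
  | 0 => pure none
  | n + 1 => do
      let r ← round E p H
      match r with
      | some l => pure (some l)
      | none => rounds E p H n

/-- The algorithm terminates with the output `l` after `c` elementary operations. -/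
def Terminates [NeZero A] (E : Env A d) (p : Params) (H : ℕ) (l : List (Fin A)) (c : ℕ) : Prop :=
  ∃ n, ((rounds E p H n).run (Machine.start A d)).1 = some l ∧
    ((rounds E p H n).run (Machine.start A d)).2.steps = c

end Programs

/-! ### The value of the inversion routine -/

section InvGram

variable {A d : ℕ}

theorem tabulate_fst {α : Type} (n : ℕ) (f : Fin n → Prog A d α) (v : Fin n → α)
    (hf : ∀ i m, ((f i).run m).1 = v i) (m : Machine A d) : ((tabulate n f).run m).1 = v := by
  induction n generalizing m with
  | zero => exact Subsingleton.elim _ _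
  | succ n ih =>
    funext i
    have h1 := ih (fun i => f i.succ) (fun i => v i.succ) (fun i m => hf i.succ m)
      ((f 0).run m).2
    have h0 := hf 0 m
    have : ((tabulate (n + 1) f).run m).1 = Fin.cons ((f 0).run m).1
      ((tabulate n (fun i => f i.succ)).run ((f 0).run m).2).1 := rfl
    rw [this, h0, h1]
    refine Fin.cases ?_ (fun j => ?_) i <;> simp

theorem sumUp_fst (n : ℕ) (f : Fin n → Prog A d ℝ) (v : Fin n → ℝ)
    (hf : ∀ i m, ((f i).run m).1 = v i) (m : Machine A d) :
    ((sumUp n f).run m).1 = ∑ i, v i := by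
  induction n generalizing m with
  | zero =>
    have : ((sumUp 0 f).run m).1 = 0 := rfl
    simpa using this
  | succ n ih =>
    have h1 := ih (fun i => f i.castSucc) (fun i => v i.castSucc) (fun i m => hf i.castSucc m) m
    have h0 := hf (Fin.last n) ((sumUp n fun i => f i.castSucc).run m).2
    have : ((sumUp (n + 1) f).run m).1 = ((sumUp n fun i => f i.castSucc).run m).1 +
      ((f (Fin.last n)).run ((sumUp n fun i => f i.castSucc).run m).2).1 := rfl
    rw [this, h0, h1, Fin.sum_univ_castSucc]

theorem dot_fst (x y : Vec d) (m : Machine A d) : ((dot x y).run m).1 = x ⬝ᵥ y :=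
  sumUp_fst d _ (fun i => x i * y i) (fun _ _ => rfl) m

theorem matVec_fst (P : Fin d → Vec d) (x : Vec d) (m : Machine A d) :
    ((matVec P x).run m).1 = (Matrix.of P).mulVec x :=
  tabulate_fst d _ _ (fun i m => dot_fst (P i) x m) m

/-- The regularized Gram matrix `∑ x xᵀ + lam I`. -/
def gram (lam : ℝ) (l : List (Vec d)) : Matrix (Fin d) (Fin d) ℝ :=
  (l.map fun x => Matrix.vecMulVec x x).sum + lam • (1 : Matrix (Fin d) (Fin d) ℝ)

theorem gram_posDef {lam : ℝ} (hlam : 0 < lam) (l : List (Vec d)) : (gram lam l).PosDef := by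
  induction l with
  | nil => simpa [gram] using Matrix.PosDef.one.smul hlam
  | cons x l ih =>
    have : gram lam (x :: l) = gram lam l + Matrix.vecMulVec x x := by
      simp [gram, add_comm, add_left_comm]
    rw [this]
    refine ih.add_posSemidef ?_
    simpa using Matrix.posSemidef_vecMulVec_self_star x

theorem invGram_eq {lam : ℝ} (hlam : 0 < lam) (l : List (Vec d)) (m : Machine A d) :
    ((invGram lam l).run m).1 = (gram lam l)⁻¹ := by
  induction l generalizing m with
  | nil =>
    have h : ((invGram lam []).run m).1 = (lam⁻¹ • (1 : Matrix (Fin d) (Fin d) ℝ)) := by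
      refine tabulate_fst d _ _ (fun i m => tabulate_fst d _ _ (fun j m => ?_) m) m
      by_cases hij : i = j
      · subst hij
        have : ((div 1 lam : Prog A d ℝ).run m).1 = 1 / lam := rfl
        simp [this]
      · rw [if_neg hij]
        have : ((pure 0 : Prog A d ℝ).run m).1 = 0 := rfl
        exact this.trans (by simp [hij])
    rw [h]
    refine (Matrix.inv_eq_right_inv ?_).symm
    simp [gram, smul_smul, hlam.ne']
  | cons x l ih =>
    set B := gram lam l with hB
    have hpd : B.PosDef := gram_posDef hlam l
    have hdet : IsUnit B.det := (Matrix.isUnit_iff_isUnit_det _).1 hpd.isUnit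
    have hsymm : (B⁻¹).transpose = B⁻¹ := by
      simpa using hpd.inv.isHermitian.eq
    set u := B⁻¹.mulVec x with hu
    have hpos : 0 ≤ x ⬝ᵥ u := by
      simpa using hpd.inv.posSemidef.dotProduct_mulVec_nonneg x
    have h : ((invGram lam (x :: l)).run m).1 =
        fun i j => B⁻¹ i j - u i * u j / (1 + x ⬝ᵥ u) := by
      set m1 := ((invGram lam l).run m).2
      set P := ((invGram lam l).run m).1 with hP
      set v := ((matVec P x).run m1).1 with hv
      set m2 := ((matVec P x).run m1).2
      have hPB : P = B⁻¹ := ih m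
      have hvu : v = u := by rw [hv, matVec_fst, hPB]; rfl
      have hs : ((dot x v).run m2).1 = x ⬝ᵥ u := by rw [dot_fst, hvu]
      rw [← hPB, ← hvu]
      refine tabulate_fst d _ _ (fun i m => tabulate_fst d _ _ (fun j m => ?_) m) _
      change P i j - v i * v j / (1 + ((dot x v).run m2).1) = _
      rw [hs, hvu]
    rw [h]
    refine (Matrix.inv_eq_right_inv ?_).symm
    have hg : gram lam (x :: l) = B + Matrix.vecMulVec x x := by
      simp [gram, hB, add_comm, add_left_comm]
    have hm : (fun i j => B⁻¹ i j - u i * u j / (1 + x ⬝ᵥ u) : Matrix (Fin d) (Fin d) ℝ) =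
        B⁻¹ - (1 + x ⬝ᵥ u)⁻¹ • Matrix.vecMulVec u u := by
      ext i j
      simp [Matrix.vecMulVec_apply]
      ring
    have hBu : B.mulVec u = x := by
      rw [hu, Matrix.mulVec_mulVec, Matrix.mul_nonsing_inv _ hdet, Matrix.one_mulVec]
    have hxB : Matrix.vecMul x B⁻¹ = u := by
      rw [← Matrix.mulVec_transpose, hsymm]
    rw [hg, hm, Matrix.mul_sub, Matrix.add_mul, Matrix.add_mul, Matrix.mul_nonsing_inv _ hdet,
      Matrix.mul_smul, Matrix.mul_smul, Matrix.mul_vecMulVec, hBu, Matrix.vecMulVec_mul, hxB,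
      Matrix.vecMulVec_mul_vecMulVec]
    ext i j
    have : (1 + x ⬝ᵥ u) ≠ 0 := by positivity
    simp [Matrix.vecMulVec_apply]
    field_simp
    ring

end InvGram

/-! ### The interaction -/

/-- One outcome of all the randomness of all episodes: for each episode and step, the observation
that is emitted if the latent state is `s`, and the reward that is drawn if the latent state is `s`
and the action is `a`. -/
abbrev Tape (S : Type*) (O : Type*) (A : ℕ) := (ℕ × ℕ × S → O) × (ℕ × ℕ × S × Fin A → ℝ)

namespace DetPOMDP

variable {S : Type*} {O : Type*} [MeasurableSpace O] {A : ℕ} (𝓜 : DetPOMDP S O A)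

/-- The law of the tape: all draws are independent and follow the laws of the model. -/
def tapeLaw : Measure (Tape S O A) :=
  (Measure.infinitePi fun i : ℕ × ℕ × S => 𝓜.emission i.2.1 i.2.2).prod
    (Measure.infinitePi fun i : ℕ × ℕ × S × Fin A => 𝓜.reward i.2.1 i.2.2.1 i.2.2.2)

/-- The environment that the algorithm faces: the answers are read off the tape at the latent state
that the actions played so far have led to. -/
def env {d : ℕ} (ψ : O → EuclideanSpace ℝ (Fin d)) (ω : Tape S O A) : Env A d where
  feat i l := (ψ (ω.1 (i, l.length, 𝓜.latent l))).ofLp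
  rew i l a := ω.2 (i, l.length, 𝓜.latent l, a)

end DetPOMDP

end EQDP

end

/-! Since transitions are deterministic, mean rewards, optimal values and mean features are
functions of the actions played; `SeqModel` keeps only these. If G has a left inverse, θ = G(GᵀG)⁻¹w
satisfies ⟨θ, Gφ(s)⟩ = ⟨w, φ(s)⟩ and ‖θ‖ ≤ ‖w‖/η(G) (`exists_lift`). So Q⋆ is linear in the mean
observation feature, with weights of norm at most Θ, and it can be learned by ridge regression (with
λ = 1) on empirical features.

Data. An exploration adds an x in the unit ball with xᵀΣ⁻¹x > ε², and this lowers tr Σ⁻¹ by at least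
ε⁴/2 (`trace_invG_cons_le`). The trace starts at d and stays nonnegative, so a dataset has at most
2d/ε⁴ entries. This holds for every outcome of the samples, and hence so do termination and the cost
bound.

Errors. At a covered feature the predictions are within less than Δ/2 of Q⋆ (`ridge_error`), so by
the gap the greedy action is exactly optimal, and only the sampling error of one reward is incurred.
At an uncovered feature all actions are tried, and a maximum does not amplify errors. Hence
`computeV` with k steps to go errs by at most kη (`Regime.computeV_spec`); regression errors never
compound.

Cost. `computeV` branches only where it explores, that is, where it creates a data point. If each
data point pays for its own branching, the amortized cost of a call is linear in the steps to go.
There are at most HN data points and HN + 1 rounds, N bounding the size of a dataset.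

Probability. `Accurate` concerns every window of M consecutive episodes and every action sequence,
so it covers whatever averages the adaptive algorithm forms; Hoeffding and a union bound suffice
(`tapeLaw_not_accurate_le`). The A^H sequences enter M only through a logarithm, at most H·A. The
number of episodes is itself linear in M, but the exponential in M beats it (`failure_le`). On this
event the output is optimal at each step, hence among all policies (`valueFrom_le`,
`valueFrom_openLoop`). -/

namespace EQDP

/-! ### Inverse Gram matrices, the trace potential and ridge regression. -/

section LinearAlgebra

variable {d : ℕ}

theorem gram_cons (lam : ℝ) (x : Vec d) (l : List (Vec d)) :
    gram lam (x :: l) = gram lam l + Matrix.vecMulVec x x := by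
  simp [gram, add_comm, add_left_comm]

theorem dot_sq_le (x y : Vec d) : (x ⬝ᵥ y) ^ 2 ≤ (x ⬝ᵥ x) * (y ⬝ᵥ y) := by
  have := Finset.sum_mul_sq_le_sq_mul_sq Finset.univ x y
  simpa [dotProduct, pow_two] using this

theorem dot_self_nonneg (x : Vec d) : 0 ≤ x ⬝ᵥ x := by
  simpa using dotProduct_star_self_nonneg x

/-- The inverse of the regularized Gram matrix. -/
noncomputable def invG (l : List (Vec d)) : Matrix (Fin d) (Fin d) ℝ := (gram 1 l)⁻¹

theorem gram_isUnit_det (l : List (Vec d)) : IsUnit (gram 1 l).det :=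
  (Matrix.isUnit_iff_isUnit_det _).1 (gram_posDef one_pos l).isUnit

theorem invG_transpose (l : List (Vec d)) : (invG l).transpose = invG l := by
  simpa [invG] using (gram_posDef one_pos l).inv.isHermitian.eq

theorem invG_nonneg (l : List (Vec d)) (x : Vec d) : 0 ≤ x ⬝ᵥ (invG l).mulVec x := by
  simpa [invG] using (gram_posDef one_pos l).inv.posSemidef.dotProduct_mulVec_nonneg x

theorem invG_comm (l : List (Vec d)) (x y : Vec d) :
    x ⬝ᵥ (invG l).mulVec y = y ⬝ᵥ (invG l).mulVec x := by
  rw [Matrix.dotProduct_mulVec, ← Matrix.mulVec_transpose, invG_transpose, dotProduct_comm]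

theorem gram_mulVec_invG (l : List (Vec d)) (x : Vec d) :
    (gram 1 l).mulVec ((invG l).mulVec x) = x := by
  rw [invG, Matrix.mulVec_mulVec, Matrix.mul_nonsing_inv _ (gram_isUnit_det l), Matrix.one_mulVec]

theorem invG_mulVec_gram (l : List (Vec d)) (x : Vec d) :
    (invG l).mulVec ((gram 1 l).mulVec x) = x := by
  rw [invG, Matrix.mulVec_mulVec, Matrix.nonsing_inv_mul _ (gram_isUnit_det l), Matrix.one_mulVec]

/-- Cauchy–Schwarz for the quadratic form of the inverse Gram matrix. -/
theorem invG_cauchy (l : List (Vec d)) (x y : Vec d) :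
    (x ⬝ᵥ (invG l).mulVec y) ^ 2 ≤
      (x ⬝ᵥ (invG l).mulVec x) * (y ⬝ᵥ (invG l).mulVec y) := by
  have h : ∀ t : ℝ, 0 ≤ (y ⬝ᵥ (invG l).mulVec y) * (t * t) +
      (2 * (x ⬝ᵥ (invG l).mulVec y)) * t + x ⬝ᵥ (invG l).mulVec x := by
    intro t
    have := invG_nonneg l (x + t • y)
    simp only [Matrix.mulVec_add, Matrix.mulVec_smul, dotProduct_add, add_dotProduct,
      dotProduct_smul, smul_dotProduct, smul_eq_mul, invG_comm l y x] at this
    linarith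
  have := discrim_le_zero h
  rw [discrim] at this
  nlinarith

/-- Each data vector x adds (x·u)² ≥ 0 to the form of the regularizer. -/
theorem gram_quad (l : List (Vec d)) (u : Vec d) : u ⬝ᵥ u ≤ u ⬝ᵥ (gram 1 l).mulVec u := by
  induction l with
  | nil => simp [gram]
  | cons x l ih =>
    rw [gram_cons, Matrix.add_mulVec, dotProduct_add, Matrix.vecMulVec_mulVec]
    have : 0 ≤ u ⬝ᵥ (MulOpposite.op (x ⬝ᵥ u) • x) := by
      simp only [dotProduct_smul, MulOpposite.smul_eq_mul_unop, MulOpposite.unop_op]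
      rw [dotProduct_comm u x]
      exact mul_self_nonneg _
    linarith

/-- Σ ≥ I passes to inverses: u = Σ⁻¹x has u·u ≤ u·Σu = x·u, while (x·u)² ≤ (x·x)(u·u). -/
theorem invG_quad_le (l : List (Vec d)) (x : Vec d) : x ⬝ᵥ (invG l).mulVec x ≤ x ⬝ᵥ x := by
  set u := (invG l).mulVec x with hu
  have h1 : u ⬝ᵥ u ≤ x ⬝ᵥ u := by
    have := gram_quad l u
    rwa [hu, gram_mulVec_invG, ← hu, dotProduct_comm u x] at this
  have h2 := dot_sq_le x u
  have h3 := dot_self_nonneg x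
  rcases (invG_nonneg l x).eq_or_lt with h | h
  · rw [← hu] at h; linarith
  · rw [← hu] at h
    nlinarith [mul_le_mul_of_nonneg_left h1 h3]

/-- The Sherman–Morrison formula. -/
theorem invG_cons (x : Vec d) (l : List (Vec d)) :
    invG (x :: l) = invG l - (1 + x ⬝ᵥ (invG l).mulVec x)⁻¹ •
      Matrix.vecMulVec ((invG l).mulVec x) ((invG l).mulVec x) := by
  set u := (invG l).mulVec x with hu
  have hpos : 0 ≤ x ⬝ᵥ u := invG_nonneg l x
  have hxB : Matrix.vecMul x (invG l) = u := by
    rw [← Matrix.mulVec_transpose, invG_transpose]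
  refine Matrix.inv_eq_right_inv ?_
  rw [gram_cons, Matrix.mul_sub, Matrix.add_mul, Matrix.add_mul, Matrix.mul_smul,
    Matrix.mul_smul, Matrix.mul_vecMulVec, hu, gram_mulVec_invG, ← hu, Matrix.vecMulVec_mul, hxB,
    Matrix.vecMulVec_mul_vecMulVec, invG, Matrix.mul_nonsing_inv _ (gram_isUnit_det l)]
  ext i j
  have : (1 + x ⬝ᵥ u) ≠ 0 := by positivity
  simp [Matrix.vecMulVec_apply]
  field_simp
  ring

theorem trace_invG_nil : (invG ([] : List (Vec d))).trace = d := by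
  simp [invG, gram]

theorem trace_invG_nonneg (l : List (Vec d)) : 0 ≤ (invG l).trace :=
  (gram_posDef one_pos l).inv.posSemidef.trace_nonneg

/-- Adding an uncovered vector to the dataset decreases the trace of the inverse Gram matrix. -/
theorem trace_invG_cons_le {ε : ℝ} (hε : 0 < ε) (hε1 : ε ≤ 1) (x : Vec d) (l : List (Vec d))
    (hx : x ⬝ᵥ x ≤ 1) (hq : ε ^ 2 < x ⬝ᵥ (invG l).mulVec x) :
    (invG (x :: l)).trace + ε ^ 4 / 2 ≤ (invG l).trace := by
  -- The trace drops by u·u/(1 + q), where u = Σ⁻¹x and q = x·u. Here q² ≤ u·u because x is in the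
  -- unit ball, and ε² < q ≤ 1, so the drop is at least q²/2 ≥ ε⁴/2.
  rw [invG_cons, Matrix.trace_sub, Matrix.trace_smul, Matrix.trace_vecMulVec]
  set u := (invG l).mulVec x with hu
  set q := x ⬝ᵥ u with hq'
  have h1 : q ^ 2 ≤ u ⬝ᵥ u := by
    have := dot_sq_le x u
    nlinarith [dot_self_nonneg u]
  have hε2 : ε ^ 2 ≤ 1 := pow_le_one₀ hε.le hε1
  have hq0 : 0 < q := lt_trans (by positivity) hq
  have hq1 : q ≤ 1 := (invG_quad_le l x).trans hx
  have h2 : ε ^ 4 / 2 ≤ (1 + q)⁻¹ * (u ⬝ᵥ u) := by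
    rw [inv_mul_eq_div, div_le_div_iff₀ two_pos (by linarith)]
    have : ε ^ 4 ≤ q ^ 2 := by
      have := pow_le_pow_left₀ (by positivity) hq.le 2
      calc ε ^ 4 = (ε ^ 2) ^ 2 := by ring
        _ ≤ _ := this
    nlinarith [pow_pos hε 4]
  rw [smul_eq_mul]
  linarith

/-- The vector `∑ y x` over a list of pairs `(x, y)`. -/
def momentSum (L : List (Vec d × ℝ)) : Vec d := (L.map fun z => fun i => z.1 i * z.2).sum

theorem momentSum_cons (z : Vec d × ℝ) (L : List (Vec d × ℝ)) :
    momentSum (z :: L) = z.2 • z.1 + momentSum L := by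
  simp only [momentSum, List.map_cons, List.sum_cons]
  congr 1
  ext i
  simp [mul_comm]

/-- Since Σθ − θ = ∑ (θ·x)x, the difference is ∑ (y − θ·x)(b·x), with terms at most ζc. Ridge
regression needs it for b = Σ⁻¹x₀ at a test vector x₀. -/
theorem momentSum_error (L : List (Vec d × ℝ)) (θ b : Vec d) {ζ c : ℝ}
    (hL : ∀ z ∈ L, |z.2 - θ ⬝ᵥ z.1| ≤ ζ) (hb : ∀ z ∈ L, |b ⬝ᵥ z.1| ≤ c) :
    |b ⬝ᵥ momentSum L - b ⬝ᵥ ((gram 1 (L.map Prod.fst)).mulVec θ - θ)| ≤ L.length * (ζ * c) := by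
  induction L with
  | nil => simp [momentSum, gram]
  | cons z L ih =>
    have h1 := ih (fun w hw => hL w (List.mem_cons_of_mem _ hw))
      (fun w hw => hb w (List.mem_cons_of_mem _ hw))
    have h2 := hL z List.mem_cons_self
    have h3 := hb z List.mem_cons_self
    have h4 : |(z.2 - θ ⬝ᵥ z.1) * (b ⬝ᵥ z.1)| ≤ ζ * c := by
      rw [abs_mul]
      exact mul_le_mul h2 h3 (abs_nonneg _) ((abs_nonneg _).trans h2)
    have h5 : b ⬝ᵥ momentSum (z :: L) -
        b ⬝ᵥ ((gram 1 ((z :: L).map Prod.fst)).mulVec θ - θ) =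
        (b ⬝ᵥ momentSum L - b ⬝ᵥ ((gram 1 (L.map Prod.fst)).mulVec θ - θ)) +
          (z.2 - θ ⬝ᵥ z.1) * (b ⬝ᵥ z.1) := by
      rw [List.map_cons, gram_cons, momentSum_cons, Matrix.add_mulVec, Matrix.vecMulVec_mulVec]
      simp only [dotProduct_add, dotProduct_sub, dotProduct_smul, smul_eq_mul,
        MulOpposite.smul_eq_mul_unop, MulOpposite.unop_op, dotProduct_comm z.1 θ]
      ring
    rw [h5]
    refine (abs_add_le _ _).trans ?_
    push_cast [List.length_cons]
    linarith

/-- The error of ridge regression at a covered vector. -/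
theorem ridge_error {L : List (Vec d × ℝ)} {F : List (Vec d)} (hF : L.map Prod.fst = F)
    (θ x : Vec d) {ζ ε Θ : ℝ} (hε : 0 ≤ ε) (hΘ : 0 ≤ Θ) (hθ : θ ⬝ᵥ θ ≤ Θ ^ 2)
    (hF1 : ∀ z ∈ F, z ⬝ᵥ z ≤ 1)
    (hL : ∀ z ∈ L, |z.2 - θ ⬝ᵥ z.1| ≤ ζ) (hx : x ⬝ᵥ (invG F).mulVec x ≤ ε ^ 2) :
    |(invG F).mulVec (momentSum L) ⬝ᵥ x - θ ⬝ᵥ x| ≤ ε * Θ + F.length * (ζ * ε) := by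
  subst hF
  set F := L.map Prod.fst with hF
  -- The prediction error is b·∑ yᵢxᵢ − b·Σθ, that is, the noise term b·∑ (yᵢ − θ·xᵢ)xᵢ minus the
  -- bias b·θ. Cauchy–Schwarz in the Σ⁻¹ form, with coverage of x and Σ⁻¹ ≤ I, bounds each |b·xᵢ| by
  -- ε and the bias by εΘ.
  set b := (invG F).mulVec x with hb
  have hbz : ∀ z ∈ L, |b ⬝ᵥ z.1| ≤ ε := by
    intro z hz
    have h1 := invG_cauchy F z.1 x
    have h2 : z.1 ⬝ᵥ (invG F).mulVec z.1 ≤ 1 :=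
      (invG_quad_le F z.1).trans (hF1 _ (List.mem_map_of_mem hz))
    rw [dotProduct_comm]
    refine abs_le_of_sq_le_sq ?_ hε
    nlinarith [invG_nonneg F x, invG_nonneg F z.1]
  have h1 := momentSum_error L θ b hL hbz
  have h2 : |b ⬝ᵥ θ| ≤ ε * Θ := by
    have h3 := invG_cauchy F θ x
    have h4 : θ ⬝ᵥ (invG F).mulVec θ ≤ Θ ^ 2 := (invG_quad_le F θ).trans hθ
    rw [dotProduct_comm]
    refine abs_le_of_sq_le_sq ?_ (by positivity)
    rw [mul_pow]
    nlinarith [invG_nonneg F x, invG_nonneg F θ, sq_nonneg ε]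
  have h3 : (invG F).mulVec (momentSum L) ⬝ᵥ x = b ⬝ᵥ momentSum L := by
    rw [dotProduct_comm, invG_comm, dotProduct_comm]
  have h4 : b ⬝ᵥ (gram 1 F).mulVec θ = θ ⬝ᵥ x := by
    rw [hb, dotProduct_comm, invG_comm, invG_mulVec_gram, dotProduct_comm]
  have h6 : (F.length : ℝ) = L.length := by simp [hF]
  rw [h3, ← h4, h6]
  rw [← hF, dotProduct_sub] at h1
  have h5 : b ⬝ᵥ momentSum L - b ⬝ᵥ (gram 1 F).mulVec θ =
    (b ⬝ᵥ momentSum L - (b ⬝ᵥ (gram 1 F).mulVec θ - b ⬝ᵥ θ)) + -(b ⬝ᵥ θ) := by ring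
  rw [h5]
  refine (abs_add_le _ _).trans ?_
  rw [abs_neg]
  linarith

end LinearAlgebra

/-! ### Singular values and the lift of weights to observation features. -/

section SingularValue

open Module

/-- In an orthonormal eigenbasis b of T*T, ‖Tv‖² = ∑ σᵢ²⟨bᵢ, v⟩², and every σᵢ is at least the last
one. -/
theorem minSingularValue_mul_norm_le {d dₛ : ℕ} (h0 : 0 < dₛ) (G : Matrix (Fin d) (Fin dₛ) ℝ)
    (v : EuclideanSpace ℝ (Fin dₛ)) :
    minSingularValue G * ‖v‖ ≤ ‖Matrix.toEuclideanLin G v‖ := by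
  set T := Matrix.toEuclideanLin G with hT
  have hn : finrank ℝ (EuclideanSpace ℝ (Fin dₛ)) = dₛ := by simp
  have hs := T.isSymmetric_adjoint_comp_self
  set b := hs.eigenvectorBasis hn
  have hpos : 0 ≤ minSingularValue G := T.singularValues_nonneg _
  refine le_of_sq_le_sq ?_ (norm_nonneg _)
  have h1 : ‖T v‖ ^ 2 = ∑ i : Fin dₛ, T.singularValues i ^ 2 * (inner ℝ (b i) v) ^ 2 := by
    rw [← real_inner_self_eq_norm_sq, ← LinearMap.adjoint_inner_right]
    have : LinearMap.adjoint T (T v) = (LinearMap.adjoint T ∘ₗ T) v := rfl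
    rw [this, ← b.sum_inner_mul_inner]
    refine Finset.sum_congr rfl fun i _ => ?_
    rw [← hs (b i) v, hs.apply_eigenvectorBasis, T.sq_singularValues_fin hn i, real_inner_comm]
    simp only [inner_smul_left]
    simp
    ring
  have h2 : ‖v‖ ^ 2 = ∑ i, (inner ℝ (b i) v) ^ 2 := by
    rw [← b.sum_sq_norm_inner_right v]
    simp
  rw [mul_pow, h1, h2, Finset.mul_sum]
  refine Finset.sum_le_sum fun i _ => ?_
  refine mul_le_mul_of_nonneg_right (pow_le_pow_left₀ hpos ?_ 2) (sq_nonneg _)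
  exact T.singularValues_antitone (by omega)

theorem minSingularValue_pos {d dₛ : ℕ} (h0 : 0 < dₛ) {G : Matrix (Fin d) (Fin dₛ) ℝ}
    {L : Matrix (Fin dₛ) (Fin d) ℝ} (hL : L * G = 1) : 0 < minSingularValue G := by
  have hinj : Function.Injective (Matrix.toEuclideanLin G) := by
    intro x y hxy
    have h : G.mulVec x.ofLp = G.mulVec y.ofLp := by
      simpa [Matrix.toLpLin_apply] using hxy
    have := congrArg (L.mulVec) h
    rw [Matrix.mulVec_mulVec, Matrix.mulVec_mulVec, hL, Matrix.one_mulVec,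
      Matrix.one_mulVec] at this
    exact WithLp.ofLp_injective 2 this
  refine (LinearMap.injective_iff_forall_lt_finrank_singularValues_pos _).1 hinj _ ?_
  simp
  omega

/-- A weight vector for the state feature lifts to a weight vector for the mean of the observation
feature. -/
theorem exists_lift {d dₛ : ℕ} (h0 : 0 < dₛ) {G : Matrix (Fin d) (Fin dₛ) ℝ}
    {L : Matrix (Fin dₛ) (Fin d) ℝ} (hL : L * G = 1) (w : EuclideanSpace ℝ (Fin dₛ)) :
    ∃ θ : EuclideanSpace ℝ (Fin d), ‖θ‖ ≤ ‖w‖ / minSingularValue G ∧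
      ∀ v, inner ℝ θ (Matrix.toEuclideanLin G v) = inner ℝ w v := by
  have hη := minSingularValue_pos h0 hL
  have hle := minSingularValue_mul_norm_le h0 G
  set T := Matrix.toEuclideanLin G with hT
  set R := LinearMap.adjoint T ∘ₗ T with hR
  have hinj : Function.Injective R := by
    rw [injective_iff_map_eq_zero]
    intro u hu
    have : inner ℝ u (R u) = inner ℝ (T u) (T u) := LinearMap.adjoint_inner_right T u (T u)
    rw [hu, inner_zero_right, real_inner_self_eq_norm_sq] at this
    have h1 : ‖T u‖ = 0 := by simpa using this.symm
    have h2 := hle u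
    rw [h1] at h2
    have : ‖u‖ ≤ 0 := by nlinarith [norm_nonneg u]
    simpa using this
  obtain ⟨u, hu⟩ := (LinearMap.injective_iff_surjective.1 hinj) w
  -- With u = (T*T)⁻¹w, ⟨Tu, Tv⟩ = ⟨w, v⟩ is the adjoint relation. For the norm, ‖Tu‖² = ⟨u, w⟩ ≤
  -- ‖u‖‖w‖, and ‖u‖ is at most ‖Tu‖ over the smallest singular value.
  refine ⟨T u, ?_, fun v => ?_⟩
  · have h1 : ‖T u‖ ^ 2 = inner ℝ u w := by
      rw [← hu, ← real_inner_self_eq_norm_sq]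
      exact (LinearMap.adjoint_inner_right T u (T u)).symm
    have h2 := real_inner_le_norm u w
    rw [le_div_iff₀ hη]
    rcases (norm_nonneg (T u)).eq_or_lt with h | h
    · rw [← h]; simp
    · have h3 := hle u
      have h4 : ‖T u‖ * (‖T u‖ * minSingularValue G) ≤ ‖T u‖ * ‖w‖ := by
        nlinarith [norm_nonneg w]
      exact le_of_mul_le_mul_left h4 h
  · rw [← hu]
    exact (LinearMap.adjoint_inner_left T v (T u)).symm

end SingularValue

/-! ### Program logic: values and costs of the elementary routines. -/

section Semantics

variable {A d : ℕ} {α β : Type}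

/-- The postcondition `Q` holds for the result and the final machine of a run from `m`. -/
def wp (p : Prog A d α) (m : Machine A d) (Q : α → Machine A d → Prop) : Prop :=
  Q (p.run m).1 (p.run m).2

theorem wp_pure {x : α} {m : Machine A d} {Q : α → Machine A d → Prop} (h : Q x m) :
    wp (pure x) m Q := h

theorem wp_bind {p : Prog A d α} {f : α → Prog A d β} {m : Machine A d}
    {Q : β → Machine A d → Prop} (h : wp p m fun x m' => wp (f x) m' Q) : wp (p >>= f) m Q := h

theorem wp.mono {p : Prog A d α} {m : Machine A d} {Q R : α → Machine A d → Prop}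
    (h : wp p m Q) (hQR : ∀ x m', Q x m' → R x m') : wp p m R := hQR _ _ h

theorem wp.and {p : Prog A d α} {m : Machine A d} {Q R : α → Machine A d → Prop}
    (h : wp p m Q) (h' : wp p m R) : wp p m fun x m' => Q x m' ∧ R x m' := ⟨h, h'⟩

/-- The machine after `k` further elementary operations. -/
def Machine.tick (m : Machine A d) (k : ℕ) : Machine A d := { m with steps := m.steps + k }

theorem Machine.tick_tick (m : Machine A d) (k l : ℕ) : (m.tick k).tick l = m.tick (k + l) := by
  simp [Machine.tick, add_assoc]

theorem wp_le_bind {x y : ℝ} {f : Bool → Prog A d β} {m : Machine A d}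
    {Q : β → Machine A d → Prop} (h : wp (f (decide (x ≤ y))) (m.tick 1) Q) :
    wp (le x y >>= f) m Q := h

theorem wp_get_bind {f : Machine A d → Prog A d β} {m : Machine A d}
    {Q : β → Machine A d → Prop} (h : wp (f m) m Q) : wp (get >>= f) m Q := h

/-- A program whose only effect is to perform at most `c` elementary operations. -/
def Quiet (p : Prog A d α) (c : ℕ) : Prop := ∀ m, ∃ k ≤ c, (p.run m).2 = m.tick k

theorem Quiet.mono {p : Prog A d α} {c c' : ℕ} (h : Quiet p c) (hc : c ≤ c') : Quiet p c' :=
  fun m => let ⟨k, hk, e⟩ := h m; ⟨k, hk.trans hc, e⟩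

theorem Quiet.pure (x : α) : Quiet (pure x : Prog A d α) 0 := fun _ => ⟨0, le_rfl, rfl⟩

theorem Quiet.bind {p : Prog A d α} {f : α → Prog A d β} {c c' : ℕ} (hp : Quiet p c)
    (hf : ∀ x, Quiet (f x) c') : Quiet (p >>= f) (c + c') := by
  intro m
  obtain ⟨k, hk, e⟩ := hp m
  obtain ⟨k', hk', e'⟩ := hf (p.run m).1 (p.run m).2
  refine ⟨k + k', add_le_add hk hk', ?_⟩
  rw [← Machine.tick_tick, ← e]
  exact e'

theorem quiet_add (x y : ℝ) : Quiet (add x y : Prog A d ℝ) 1 := fun _ => ⟨1, le_rfl, rfl⟩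
theorem quiet_sub (x y : ℝ) : Quiet (sub x y : Prog A d ℝ) 1 := fun _ => ⟨1, le_rfl, rfl⟩
theorem quiet_mul (x y : ℝ) : Quiet (mul x y : Prog A d ℝ) 1 := fun _ => ⟨1, le_rfl, rfl⟩
theorem quiet_div (x y : ℝ) : Quiet (div x y : Prog A d ℝ) 1 := fun _ => ⟨1, le_rfl, rfl⟩
theorem quiet_le (x y : ℝ) : Quiet (le x y : Prog A d Bool) 1 := fun _ => ⟨1, le_rfl, rfl⟩

theorem quiet_tabulate {n c : ℕ} {f : Fin n → Prog A d α} (hf : ∀ i, Quiet (f i) c) :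
    Quiet (tabulate n f) (n * c) := by
  induction n with
  | zero => exact (Quiet.pure _).mono (Nat.zero_le _)
  | succ n ih =>
    refine ((hf 0).bind fun x => (ih fun i => hf i.succ).bind fun xs => Quiet.pure _).mono ?_
    rw [Nat.succ_mul]; omega

theorem quiet_sumUp {n c : ℕ} {f : Fin n → Prog A d ℝ} (hf : ∀ i, Quiet (f i) c) :
    Quiet (sumUp n f) (n * (c + 1)) := by
  induction n with
  | zero => exact (Quiet.pure _).mono (Nat.zero_le _)
  | succ n ih =>
    refine ((ih fun i => hf i.castSucc).bind fun x => (hf _).bind fun xs => quiet_add _ _).mono ?_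
    rw [Nat.succ_mul]

theorem quiet_vecAdd (x y : Vec d) : Quiet (vecAdd x y : Prog A d (Vec d)) (d * 1) :=
  quiet_tabulate fun _ => quiet_add _ _

theorem quiet_dot (x y : Vec d) : Quiet (dot x y : Prog A d ℝ) (d * 2) :=
  quiet_sumUp fun _ => quiet_mul _ _

theorem quiet_matVec (P : Fin d → Vec d) (x : Vec d) :
    Quiet (matVec P x : Prog A d (Vec d)) (d * (d * 2)) :=
  quiet_tabulate fun _ => quiet_dot _ _

theorem quiet_invGram (lam : ℝ) (l : List (Vec d)) :
    Quiet (invGram lam l : Prog A d (Fin d → Vec d))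
      (d * (d * 1) + l.length * (d * (d * 5) + d * 2 + 1)) := by
  induction l with
  | nil =>
    refine (quiet_tabulate fun i => quiet_tabulate fun j => ?_).mono (Nat.le_add_right _ _)
    split_ifs
    · exact quiet_div _ _
    · exact (Quiet.pure _).mono (Nat.zero_le _)
  | cons x l ih =>
    refine (ih.bind fun P => (quiet_matVec P x).bind fun u => (quiet_dot x u).bind fun s =>
      (quiet_add 1 s).bind fun c => quiet_tabulate fun i => quiet_tabulate fun j =>
        (quiet_mul _ _).bind fun p => (quiet_div _ _).bind fun q => quiet_sub _ _).mono ?_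
    rw [List.length_cons]
    ring_nf
    omega

theorem quiet_moment (l : List (Vec d × ℝ)) :
    Quiet (moment l : Prog A d (Vec d)) (l.length * (d * 2)) := by
  induction l with
  | nil => exact (Quiet.pure _).mono (Nat.zero_le _)
  | cons z l ih =>
    refine (ih.bind fun s => (quiet_tabulate fun i => quiet_mul _ _).bind fun t =>
      quiet_vecAdd _ _).mono ?_
    rw [List.length_cons]
    ring_nf
    omega

theorem vecAdd_fst (x y : Vec d) (m : Machine A d) : ((vecAdd x y).run m).1 = x + y :=
  tabulate_fst d _ _ (fun _ _ => rfl) m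

theorem moment_fst (l : List (Vec d × ℝ)) (m : Machine A d) :
    ((moment l).run m).1 = momentSum l := by
  induction l generalizing m with
  | nil => rfl
  | cons z l ih =>
    refine (vecAdd_fst _ _ _).trans ?_
    have ih' : (moment l m).1 = momentSum l := ih m
    rw [ih']
    have := tabulate_fst d (fun i => (mul (z.1 i) z.2 : Prog A d ℝ)) (fun i => z.1 i * z.2)
      (fun _ _ => rfl) ((moment l).run m).2
    simp only [momentSum, List.map_cons, List.sum_cons]
    rw [add_comm]
    exact congrArg (· + momentSum l) this

theorem invGram_fst (l : List (Vec d)) (m : Machine A d) :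
    ((invGram 1 l).run m).1 = invG l := invGram_eq one_pos l m

theorem wp_argmaxFrom (v : Fin A → ℝ) (l : List (Fin A)) (b : Fin A) (m : Machine A d) :
    wp (argmaxFrom v l b) m fun r m' =>
      (v b ≤ v r ∧ ∀ a ∈ l, v a ≤ v r) ∧ ∃ k ≤ l.length, m' = m.tick k := by
  induction l generalizing b m with
  | nil => exact ⟨⟨le_rfl, by simp⟩, 0, le_rfl, rfl⟩
  | cons a l ih =>
    refine wp_le_bind ?_
    have key : ∀ c, v a ≤ v c → v b ≤ v c → wp (argmaxFrom v l c) (m.tick 1) fun r m' =>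
        (v b ≤ v r ∧ ∀ a' ∈ a :: l, v a' ≤ v r) ∧ ∃ k ≤ (a :: l).length, m' = m.tick k := by
      intro c hac hbc
      refine (ih c (m.tick 1)).mono ?_
      rintro r m' ⟨⟨h1, h2⟩, k, hk, e⟩
      refine ⟨⟨hbc.trans h1, ?_⟩, 1 + k, ?_, by rw [e, Machine.tick_tick]⟩
      · intro a' ha'
        rcases List.mem_cons.1 ha' with rfl | h
        · exact hac.trans h1
        · exact h2 _ h
      · rw [List.length_cons]; omega
    by_cases h : v a ≤ v b
    · rw [if_pos (by simpa using h)]; exact key b h le_rfl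
    · rw [if_neg (by simpa using h)]; exact key a le_rfl (not_le.1 h).le

theorem wp_argmax [NeZero A] (v : Fin A → ℝ) (m : Machine A d) :
    wp (argmax v) m fun r m' => (∀ a, v a ≤ v r) ∧ ∃ k ≤ A, m' = m.tick k := by
  refine (wp_argmaxFrom v (List.finRange A) 0 m).mono ?_
  rintro r m' ⟨⟨_, h⟩, k, hk, e⟩
  exact ⟨fun a => h a (List.mem_finRange a), k, by simpa using hk, e⟩

/-- Bound for the number of elementary operations of a coverage test with `n` vectors. -/
def coverCost (d n : ℕ) : ℕ :=
  d * (d * 1) + n * (d * (d * 5) + d * 2 + 1) + (d * (d * 2) + (d * 2 + (1 + 1)))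

theorem wp_covered {p : Params} (hp : p.lam = 1) (h : ℕ) (x : Vec d) (m : Machine A d) :
    wp (covered p h x) m fun b m' =>
      (b = true ↔ x ⬝ᵥ (invG (m.feats h)).mulVec x ≤ p.ε ^ 2) ∧
        ∃ k ≤ coverCost d (m.feats h).length, m' = m.tick k := by
  have hq : Quiet (do
      let P ← invGram p.lam (m.feats h)
      let u ← matVec P x
      let q ← dot x u
      let e ← mul p.ε p.ε
      le q e : Prog A d Bool) (coverCost d (m.feats h).length) :=
    (quiet_invGram _ _).bind fun P => (quiet_matVec P x).bind fun u => (quiet_dot x u).bind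
      fun q => (quiet_mul _ _).bind fun e => quiet_le q e
  refine wp.and ?_ (hq m)
  unfold wp
  set P := ((invGram p.lam (m.feats h)).run m).1 with hP
  set m1 := ((invGram p.lam (m.feats h)).run m).2
  set u := ((matVec P x).run m1).1 with hu
  set m2 := ((matVec P x).run m1).2
  change decide (((dot x u).run m2).1 ≤ p.ε * p.ε) = true ↔ _
  rw [decide_eq_true_iff, dot_fst, hu, matVec_fst, hP, hp, invGram_fst, pow_two]
  rfl

/-- Bound for the number of elementary operations of a greedy choice with `n` vectors. -/
def greedyCost (A d n : ℕ) : ℕ :=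
  A * (d * (d * 1) + n * (d * (d * 5) + d * 2 + 1) + (n * (d * 2) + (d * (d * 2) + d * 2))) + A

theorem wp_greedy [NeZero A] {p : Params} (hp : p.lam = 1) (h : ℕ) (x : Vec d) (m : Machine A d)
    (hm : ∀ a, (m.pairs a h).map Prod.fst = m.feats h) :
    wp (greedy p h x) m fun b m' =>
      (∀ a, (invG (m.feats h)).mulVec (momentSum (m.pairs a h)) ⬝ᵥ x ≤
        (invG (m.feats h)).mulVec (momentSum (m.pairs b h)) ⬝ᵥ x) ∧
        ∃ k ≤ greedyCost A d (m.feats h).length, m' = m.tick k := by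
  set f : Fin A → Prog A d ℝ := fun a => do
    let P ← invGram p.lam (m.feats h)
    let b ← moment (m.pairs a h)
    let θ ← matVec P b
    dot θ x with hf
  have hlen : ∀ a, (m.pairs a h).length = (m.feats h).length := by
    intro a; rw [← hm a, List.length_map]
  have hq : ∀ a, Quiet (f a) _ := fun a =>
    (quiet_invGram p.lam (m.feats h)).bind fun P =>
      ((quiet_moment (m.pairs a h)).mono (by rw [hlen a])).bind fun b =>
        (quiet_matVec P b).bind fun θ => quiet_dot θ x
  have hv : ((tabulate A f).run m).1 =
      fun a => (invG (m.feats h)).mulVec (momentSum (m.pairs a h)) ⬝ᵥ x := by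
    refine tabulate_fst A f _ (fun a m' => ?_) m
    set P := ((invGram p.lam (m.feats h)).run m').1 with hP
    set m1 := ((invGram p.lam (m.feats h)).run m').2
    set b := ((moment (m.pairs a h)).run m1).1 with hb
    set m2 := ((moment (m.pairs a h)).run m1).2
    set θ := ((matVec P b).run m2).1 with hθ
    change ((dot θ x).run _).1 = _
    rw [dot_fst, hθ, matVec_fst, hP, hp, invGram_fst, hb, moment_fst]
    rfl
  obtain ⟨k, hk, e⟩ := quiet_tabulate hq m
  refine wp_get_bind (wp_bind (p := tabulate A f) ?_)
  unfold wp
  rw [hv, e]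
  obtain ⟨h1, k', hk', e'⟩ := wp_argmax
    (fun a => (invG (m.feats h)).mulVec (momentSum (m.pairs a h)) ⬝ᵥ x) (m.tick k)
  exact ⟨h1, k + k', add_le_add hk hk', by rw [e', Machine.tick_tick]⟩

/-! ### Sampling -/

theorem execute_snd (E : Env A d) (l : List (Fin A)) (m : Machine A d) :
    ((execute E l).run m).2 =
      { m with steps := m.steps + l.length * (d + 2), played := m.played ++ l } := by
  induction l generalizing m with
  | nil => simp [execute]; rfl
  | cons a l ih =>
    refine (ih _).trans ?_
    change ({ m with
      steps := m.steps + (1 + d) + 1 + l.length * (d + 2), played := (m.played ++ [a]) ++ l } :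
        Machine A d) = _
    congr 1
    · rw [List.length_cons]; ring
    · simp

/-- The machine after `k` further elementary operations and `n` further episodes, the last of which
has reached the actions `pl`. -/
def Machine.sampled (m : Machine A d) (k n : ℕ) (pl : List (Fin A)) : Machine A d :=
  { m with steps := m.steps + k, episode := m.episode + n, played := pl }

/-- The averages range over a window of consecutive episodes, starting at `m.episode + 1` because
`reset` increments the counter first. The lower bound `n ≤ k` serves to bound the number of episodes
by the number of operations. -/
theorem wp_featureSum (E : Env A d) (l : List (Fin A)) (n : ℕ) (m : Machine A d) :
    wp (featureSum E l n) m fun v m' =>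
      (v = fun i => ∑ j ∈ Finset.range n, E.feat (m.episode + 1 + j) l i) ∧
        ∃ k ≤ n * (l.length * (d + 2) + 2 * d + 2), n ≤ k ∧ ∃ pl, m' = m.sampled k n pl := by
  induction n with
  | zero => exact ⟨by funext i; simp; rfl, 0, Nat.zero_le _, le_rfl, m.played, rfl⟩
  | succ n ih =>
    obtain ⟨hv, k, hk, hk1, pl, e⟩ := ih
    refine wp_bind ?_
    unfold wp
    rw [hv, e]
    set s : Vec d := fun i => ∑ j ∈ Finset.range n, E.feat (m.episode + 1 + j) l i
    set m1 : Machine A d := { (m.sampled k n pl) with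
      steps := m.steps + k + 1, episode := m.episode + n + 1, played := [] }
    have hx := execute_snd E l m1
    set m2 := ((execute E l).run m1).2
    change ((vecAdd s (E.feat m2.episode m2.played)).run (m2.tick (1 + d))).1 = _ ∧
      ∃ k ≤ _, n + 1 ≤ k ∧ ∃ pl, ((vecAdd s (E.feat m2.episode m2.played)).run (m2.tick (1 + d))).2 = _
    constructor
    · rw [vecAdd_fst, hx]
      funext i
      simp only [m1, List.nil_append, Pi.add_apply, s, Finset.sum_range_succ]
      rw [show m.episode + n + 1 = m.episode + 1 + n by omega]
    · obtain ⟨k', hk', e'⟩ := quiet_vecAdd s (E.feat m2.episode m2.played) (m2.tick (1 + d))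
      refine ⟨k + 1 + l.length * (d + 2) + (1 + d) + k', ?_, by omega, l, ?_⟩
      · rw [Nat.add_mul n 1]; omega
      · rw [e', hx]
        simp only [m1, Machine.tick, Machine.sampled, List.nil_append]
        congr 1
        omega

theorem wp_featureMean (E : Env A d) (M : ℕ) (l : List (Fin A)) (m : Machine A d) :
    wp (featureMean E M l) m fun v m' =>
      (v = fun i => (∑ j ∈ Finset.range M, E.feat (m.episode + 1 + j) l i) / M) ∧
        ∃ k ≤ M * (l.length * (d + 2) + 2 * d + 2) + d, M ≤ k ∧ ∃ pl, m' = m.sampled k M pl := by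
  obtain ⟨hv, k, hk, hk1, pl, e⟩ := wp_featureSum E l M m
  refine wp_bind ?_
  unfold wp
  rw [hv, e]
  refine ⟨tabulate_fst d _ _ (fun _ _ => rfl) _, ?_⟩
  obtain ⟨k', hk', e'⟩ := quiet_tabulate (A := A) (d := d) (n := d)
    (fun i => quiet_div (∑ j ∈ Finset.range M, E.feat (m.episode + 1 + j) l i) M)
    (m.sampled k M pl)
  refine ⟨k + k', by omega, by omega, pl, ?_⟩
  rw [e']
  simp [Machine.tick, Machine.sampled, add_assoc]

theorem wp_rewardSum (E : Env A d) (l : List (Fin A)) (a : Fin A) (n : ℕ) (m : Machine A d) :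
    wp (rewardSum E l a n) m fun v m' =>
      (v = ∑ j ∈ Finset.range n, E.rew (m.episode + 1 + j) l a) ∧
        ∃ k ≤ n * (l.length * (d + 2) + d + 4), n ≤ k ∧ ∃ pl, m' = m.sampled k n pl := by
  induction n with
  | zero => exact ⟨by simp; rfl, 0, Nat.zero_le _, le_rfl, m.played, rfl⟩
  | succ n ih =>
    obtain ⟨hv, k, hk, hk1, pl, e⟩ := ih
    refine wp_bind ?_
    unfold wp
    rw [hv, e]
    set s : ℝ := ∑ j ∈ Finset.range n, E.rew (m.episode + 1 + j) l a
    set m1 : Machine A d := { (m.sampled k n pl) with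
      steps := m.steps + k + 1, episode := m.episode + n + 1, played := [] }
    have hx := execute_snd E l m1
    set m2 := ((execute E l).run m1).2
    change s + E.rew m2.episode m2.played a = _ ∧
      ∃ k ≤ _, n + 1 ≤ k ∧ ∃ pl, ({ m2 with
        steps := m2.steps + (1 + d) + 1 + 1, played := m2.played ++ [a] } : Machine A d) = _
    constructor
    · rw [hx]
      simp only [m1, List.nil_append, s, Finset.sum_range_succ]
      congr 2
      omega
    · refine ⟨k + 1 + l.length * (d + 2) + (1 + d) + 2, ?_, by omega, l ++ [a], ?_⟩
      · rw [Nat.succ_mul]; omega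
      · rw [hx]
        simp only [m1, Machine.sampled, List.nil_append]
        congr 1
        omega

theorem wp_rewardMean (E : Env A d) (M : ℕ) (l : List (Fin A)) (a : Fin A) (m : Machine A d) :
    wp (rewardMean E M l a) m fun v m' =>
      (v = (∑ j ∈ Finset.range M, E.rew (m.episode + 1 + j) l a) / M) ∧
        ∃ k ≤ M * (l.length * (d + 2) + d + 4) + 1, M ≤ k ∧ ∃ pl, m' = m.sampled k M pl := by
  obtain ⟨hv, k, hk, hk1, pl, e⟩ := wp_rewardSum E l a M m
  refine wp_bind ?_
  unfold wp
  rw [hv, e]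
  exact ⟨rfl, k + 1, by omega, by omega, pl, rfl⟩

end Semantics

/-- The quantities of a model with deterministic transitions as functions of the actions played:
mean rewards, optimal values and mean features, together with linear weights `θ` for the optimal
action values, which have a gap `Δ`. -/
structure SeqModel (H A d : ℕ) (Θ Δ : ℝ) where
  r : List (Fin A) → Fin A → ℝ
  q : List (Fin A) → Fin A → ℝ
  v : List (Fin A) → ℝ
  μ : List (Fin A) → Vec d
  θ : Fin A → ℕ → Vec d
  q_eq : ∀ l a, l.length < H → q l a = r l a + v (l ++ [a])
  v_end : ∀ l, l.length = H → v l = 0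
  q_le : ∀ l a, l.length < H → q l a ≤ v l
  exists_q_eq : ∀ l, l.length < H → ∃ a, q l a = v l
  gap : ∀ l a, l.length < H → 0 < v l - q l a → Δ ≤ v l - q l a
  lin : ∀ l a, l.length < H → q l a = θ a l.length ⬝ᵥ μ l
  θ_le : ∀ a h, h < H → θ a h ⬝ᵥ θ a h ≤ Θ ^ 2

/-! ### Accuracy, dataset invariants and amortized cost. -/

section Analysis

variable {H A d : ℕ} {Θ Δ : ℝ}

/-- All empirical means over `M` consecutive episodes up to episode `n` are accurate up to `η`. -/
def Accurate (𝓛 : SeqModel H A d Θ Δ) (E : Env A d) (M n : ℕ) (η : ℝ) : Prop :=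
  ∀ e, e + M ≤ n → ∀ l, l.length < H →
    (∀ i, |(∑ j ∈ Finset.range M, E.feat (e + 1 + j) l i) / M - 𝓛.μ l i| ≤ η) ∧
    ∀ a, |(∑ j ∈ Finset.range M, E.rew (e + 1 + j) l a) / M - 𝓛.r l a| ≤ η

/-- Accuracy of the regression targets. -/
def targetError (H d : ℕ) (Θ η : ℝ) : ℝ := (H + d * Θ) * η

/-- The parameters and the environment are such that the algorithm succeeds, as long as it uses at
most `Emax` episodes; the datasets have at most `N` entries. -/
structure Regime (𝓛 : SeqModel H A d Θ Δ) (E : Env A d) (p : Params) (N Emax : ℕ) (η : ℝ) :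
    Prop where
  lam : p.lam = 1
  M_pos : 0 < p.M
  ε_pos : 0 < p.ε
  ε_le : p.ε ≤ 1
  size : ∀ n : ℕ, n * (p.ε ^ 4 / 2) ≤ d → n ≤ N
  Θ_nonneg : 0 ≤ Θ
  η_pos : 0 < η
  precise : p.ε * Θ + N * (targetError H d Θ η * p.ε) + d * Θ * η < Δ / 2
  feat_le : ∀ i l, E.feat i l ⬝ᵥ E.feat i l ≤ 1
  accurate : Accurate 𝓛 E p.M Emax η

/-- Convexity of the square, coordinate by coordinate. Empirical features thus stay in the unit ball
on every outcome, as the trace argument requires. -/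
theorem mean_dot_le {M : ℕ} (hM : 0 < M) (f : ℕ → Vec d) (hf : ∀ j, f j ⬝ᵥ f j ≤ 1) :
    (fun i => (∑ j ∈ Finset.range M, f j i) / M : Vec d) ⬝ᵥ
      (fun i => (∑ j ∈ Finset.range M, f j i) / M) ≤ 1 := by
  have hM' : (0 : ℝ) < M := by exact_mod_cast hM
  have h1 : ∀ i : Fin d, ((∑ j ∈ Finset.range M, f j i) / M) * ((∑ j ∈ Finset.range M, f j i) / M)
      ≤ (∑ j ∈ Finset.range M, f j i * f j i) / M := by
    intro i
    have := sq_sum_le_card_mul_sum_sq (s := Finset.range M) (f := fun j => f j i)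
    rw [Finset.card_range] at this
    rw [div_mul_div_comm, div_le_div_iff₀ (by positivity) hM']
    simp only [pow_two] at this
    nlinarith
  refine (Finset.sum_le_sum fun i _ => h1 i).trans ?_
  rw [← Finset.sum_div, Finset.sum_comm, div_le_one hM']
  calc _ ≤ ∑ j ∈ Finset.range M, (1 : ℝ) := Finset.sum_le_sum fun j _ => hf j
    _ = M := by simp

/-- Features are controlled coordinatewise, which suits the union bound; summing over the
coordinates costs the factor d. -/
theorem abs_dot_le {θ z : Vec d} {η : ℝ} (hΘ : 0 ≤ Θ) (hθ : θ ⬝ᵥ θ ≤ Θ ^ 2)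
    (hz : ∀ i, |z i| ≤ η) : |θ ⬝ᵥ z| ≤ d * Θ * η := by
  have h1 : ∀ i, |θ i| ≤ Θ := fun i => by
    refine abs_le_of_sq_le_sq (le_trans ?_ hθ) hΘ
    rw [pow_two]
    exact Finset.single_le_sum (f := fun i => θ i * θ i) (fun j _ => mul_self_nonneg _)
      (Finset.mem_univ i)
  refine (Finset.abs_sum_le_sum_abs _ _).trans ?_
  calc ∑ i, |θ i * z i| ≤ ∑ i : Fin d, Θ * η := Finset.sum_le_sum fun i _ => by
        rw [abs_mul]; exact mul_le_mul (h1 i) (hz i) (abs_nonneg _) hΘ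
    _ = d * Θ * η := by simp; ring

/-- The datasets of step `j` are aligned, normalized, of bounded size, and accurate. -/
structure LevelOK (𝓛 : SeqModel H A d Θ Δ) (ε : ℝ) (Emax : ℕ) (η : ℝ) (m : Machine A d) (j : ℕ) :
    Prop where
  fst_eq : ∀ a, (m.pairs a j).map Prod.fst = m.feats j
  norm_le : ∀ x ∈ m.feats j, x ⬝ᵥ x ≤ 1
  trace_le : (invG (m.feats j)).trace + (m.feats j).length * (ε ^ 4 / 2) ≤ d
  acc : m.episode ≤ Emax → j < H → ∀ a, ∀ z ∈ m.pairs a j,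
    |z.2 - 𝓛.θ a j ⬝ᵥ z.1| ≤ targetError H d Θ η

variable {𝓛 : SeqModel H A d Θ Δ} {E : Env A d} {p : Params} {N Emax : ℕ} {η ε : ℝ}

/-- Accuracy is only claimed while the episode counter is at most `Emax`, so it persists when the
counter grows. Alignment, norms and trace are unconditional. -/
theorem LevelOK.of_eq {m m' : Machine A d} {j : ℕ} (h : LevelOK 𝓛 ε Emax η m j)
    (hf : m'.feats j = m.feats j) (hp : ∀ a, m'.pairs a j = m.pairs a j)
    (he : m.episode ≤ m'.episode) : LevelOK 𝓛 ε Emax η m' j where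
  fst_eq a := by rw [hf, hp, h.fst_eq]
  norm_le := by rw [hf]; exact h.norm_le
  trace_le := by rw [hf]; exact h.trace_le
  acc he' hj a := by rw [hp]; exact h.acc (he.trans he') hj a

/-- All datasets of the steps from `h` on satisfy the invariant. -/
def Inv (𝓛 : SeqModel H A d Θ Δ) (ε : ℝ) (Emax : ℕ) (η : ℝ) (h : ℕ) (m : Machine A d) : Prop :=
  ∀ j, h ≤ j → LevelOK 𝓛 ε Emax η m j

theorem Inv.mono {h h' : ℕ} {m : Machine A d} (hm : Inv 𝓛 ε Emax η h m) (hh : h ≤ h') :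
    Inv 𝓛 ε Emax η h' m := fun j hj => hm j (hh.trans hj)

/-- The trace is nonnegative, so the budget d pays for at most `N` drops. -/
theorem Regime.length_le (R : Regime 𝓛 E p N Emax η) {m : Machine A d} {j : ℕ}
    (h : LevelOK 𝓛 p.ε Emax η m j) : (m.feats j).length ≤ N :=
  R.size _ (by linarith [h.trace_le, trace_invG_nonneg (m.feats j)])

/-- The number of data points. -/
def dataSize (H : ℕ) (m : Machine A d) : ℕ := ∑ j ∈ Finset.range H, (m.feats j).length

theorem Regime.dataSize_le (R : Regime 𝓛 E p N Emax η) {m : Machine A d}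
    (h : Inv 𝓛 p.ε Emax η 0 m) : dataSize H m ≤ H * N := by
  refine (Finset.sum_le_sum fun j _ => R.length_le (h j (Nat.zero_le _))).trans ?_
  simp

/-- The datasets of the steps before `h` are the same. -/
def Frame (h : ℕ) (m m' : Machine A d) : Prop :=
  ∀ j, j < h → m'.feats j = m.feats j ∧ ∀ a, m'.pairs a j = m.pairs a j

theorem Frame.trans {h : ℕ} {m m' m'' : Machine A d} (h1 : Frame h m m') (h2 : Frame h m' m'') :
    Frame h m m'' := fun j hj =>
  ⟨(h2 j hj).1.trans (h1 j hj).1, fun a => ((h2 j hj).2 a).trans ((h1 j hj).2 a)⟩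

theorem Frame.mono {h h' : ℕ} {m m' : Machine A d} (h1 : Frame h' m m') (hh : h ≤ h') :
    Frame h m m' := fun j hj => h1 j (hj.trans_le hh)

/-- A run from `m` to `m'` of amortized cost at most `c`, if each new data point pays for `K`
elementary operations. -/
structure Run (H K c : ℕ) (m m' : Machine A d) : Prop where
  episode_le : m.episode ≤ m'.episode
  episode_steps : m'.episode + m.steps ≤ m.episode + m'.steps
  size_le : dataSize H m ≤ dataSize H m'
  cost : m'.steps + K * dataSize H m ≤ m.steps + c + K * dataSize H m'

theorem Run.trans {K c c' : ℕ} {m m' m'' : Machine A d} (h : Run H K c m m')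
    (h' : Run H K c' m' m'') : Run H K (c + c') m m'' where
  episode_le := h.episode_le.trans h'.episode_le
  episode_steps := by have := h.episode_steps; have := h'.episode_steps; omega
  size_le := h.size_le.trans h'.size_le
  cost := by have := h.cost; have := h'.cost; omega

theorem Run.mono {K c c' : ℕ} {m m' : Machine A d} (h : Run H K c m m') (hc : c ≤ c') :
    Run H K c' m m' where
  episode_le := h.episode_le
  episode_steps := h.episode_steps
  size_le := h.size_le
  cost := by have := h.cost; omega

theorem run_tick {K c k : ℕ} (m : Machine A d) (hk : k ≤ c) : Run H K c m (m.tick k) where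
  episode_le := le_rfl
  episode_steps := by simp [Machine.tick]
  size_le := le_rfl
  cost := by simp [Machine.tick, dataSize]; omega

theorem run_sampled {K c k n : ℕ} {pl : List (Fin A)} (m : Machine A d) (hk : k ≤ c)
    (hn : n ≤ k) : Run H K c m (m.sampled k n pl) where
  episode_le := by simp [Machine.sampled]
  episode_steps := by simp [Machine.sampled]; omega
  size_le := le_rfl
  cost := by simp [Machine.sampled, dataSize]; omega

/-- A run that leaves all datasets unchanged. -/
structure DataRun (H K c : ℕ) (m m' : Machine A d) : Prop where
  run : Run H K c m m'
  feats : m'.feats = m.feats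
  pairs : m'.pairs = m.pairs

theorem DataRun.trans {K c c' : ℕ} {m m' m'' : Machine A d} (h : DataRun H K c m m')
    (h' : DataRun H K c' m' m'') : DataRun H K (c + c') m m'' :=
  ⟨h.run.trans h'.run, h'.feats.trans h.feats, h'.pairs.trans h.pairs⟩

theorem DataRun.mono {K c c' : ℕ} {m m' : Machine A d} (h : DataRun H K c m m') (hc : c ≤ c') :
    DataRun H K c' m m' := ⟨h.run.mono hc, h.feats, h.pairs⟩

theorem DataRun.inv {K c h : ℕ} {m m' : Machine A d} (hr : DataRun H K c m m')
    (hm : Inv 𝓛 ε Emax η h m) : Inv 𝓛 ε Emax η h m' := fun j hj =>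
  (hm j hj).of_eq (by rw [hr.feats]) (fun a => by rw [hr.pairs]) hr.run.episode_le

theorem DataRun.frame {K c h : ℕ} {m m' : Machine A d} (hr : DataRun H K c m m') :
    Frame h m m' := fun j _ => ⟨by rw [hr.feats], fun a => by rw [hr.pairs]⟩

theorem dataRun_tick {K c k : ℕ} (m : Machine A d) (hk : k ≤ c) :
    DataRun H K c m (m.tick k) := ⟨run_tick m hk, rfl, rfl⟩

theorem dataRun_sampled {K c k n : ℕ} {pl : List (Fin A)} (m : Machine A d) (hk : k ≤ c)
    (hn : n ≤ k) : DataRun H K c m (m.sampled k n pl) := ⟨run_sampled m hk hn, rfl, rfl⟩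

/-- A rule for loops, with an invariant that depends on the values computed so far. -/
theorem wp_tabulate {α : Type} {n : ℕ} {f : Fin n → Prog A d α}
    (J : ℕ → (Fin n → α) → Machine A d → Prop)
    (hf : ∀ (i : Fin n) v m, J i v m →
      wp (f i) m fun y m' => J (i + 1) (Function.update v i y) m')
    (v : Fin n → α) (m : Machine A d) (h0 : J 0 v m) :
    wp (tabulate n f) m fun v m' => J n v m' := by
  induction n generalizing m with
  | zero =>
    have : v = Fin.elim0 := Subsingleton.elim _ _
    subst this
    exact h0
  | succ n ih =>
    have h1 := hf 0 v m h0
    refine wp_bind (h1.mono fun y m1 hy => ?_)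
    refine wp_bind ((ih (f := fun i => f i.succ) (fun i w => J (i + 1) (Fin.cons y w)) ?_
      (fun i => v i.succ) m1 ?_).mono fun w m2 hw => hw)
    · intro i w m' hw
      have := hf i.succ (Fin.cons y w) m' (by simpa using hw)
      simpa [Fin.cons_update] using this
    · have h2 : (Fin.cons y fun i => v i.succ : Fin (n + 1) → α) = Function.update v 0 y := by
        ext i
        refine Fin.cases ?_ (fun j => ?_) i <;> simp
      rw [h2]
      simpa using hy

/-- Bound for the cost of one sample mean. -/
def sampleCost (H d M : ℕ) : ℕ := M * (H * (d + 2) + 2 * d + 4) + d + 1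

theorem Regime.wp_featureMean (R : Regime 𝓛 E p N Emax η) (K : ℕ) {l : List (Fin A)}
    (hl : l.length < H) (m : Machine A d) :
    wp (featureMean E p.M l) m fun x m' =>
      DataRun H K (sampleCost H d p.M) m m' ∧ x ⬝ᵥ x ≤ 1 ∧
        (m'.episode ≤ Emax → ∀ i, |x i - 𝓛.μ l i| ≤ η) := by
  refine (EQDP.wp_featureMean E p.M l m).mono ?_
  rintro x m' ⟨rfl, k, hk, hk1, pl, rfl⟩
  refine ⟨dataRun_sampled m (hk.trans ?_) hk1, mean_dot_le R.M_pos
    (fun j => E.feat (m.episode + 1 + j) l) fun j => R.feat_le _ _, fun he i => ?_⟩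
  · unfold sampleCost
    have : p.M * (l.length * (d + 2) + 2 * d + 2) ≤ p.M * (H * (d + 2) + 2 * d + 4) := by
      gcongr; omega
    omega
  · exact (R.accurate m.episode he l hl).1 i

theorem Regime.wp_rewardMean (R : Regime 𝓛 E p N Emax η) (K : ℕ) {l : List (Fin A)}
    (hl : l.length < H) (a : Fin A) (m : Machine A d) :
    wp (rewardMean E p.M l a) m fun x m' =>
      DataRun H K (sampleCost H d p.M) m m' ∧ (m'.episode ≤ Emax → |x - 𝓛.r l a| ≤ η) := by
  refine (EQDP.wp_rewardMean E p.M l a m).mono ?_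
  rintro x m' ⟨rfl, k, hk, hk1, pl, rfl⟩
  refine ⟨dataRun_sampled m (hk.trans ?_) hk1, fun he => ?_⟩
  · unfold sampleCost
    have : p.M * (l.length * (d + 2) + d + 4) ≤ p.M * (H * (d + 2) + 2 * d + 4) := by
      gcongr; omega
    omega
  · exact (R.accurate m.episode he l hl).2 a

/-- Whether a vector is covered by a dataset. -/
def Covered (ε : ℝ) (F : List (Vec d)) (x : Vec d) : Prop := x ⬝ᵥ (invG F).mulVec x ≤ ε ^ 2

theorem Regime.wp_covered (R : Regime 𝓛 E p N Emax η) (K : ℕ) {h : ℕ} (x : Vec d)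
    {m : Machine A d} (hm : LevelOK 𝓛 p.ε Emax η m h) :
    wp (covered p h x) m fun b m' =>
      (b = true ↔ Covered p.ε (m.feats h) x) ∧ DataRun H K (coverCost d N) m m' := by
  refine (EQDP.wp_covered R.lam h x m).mono ?_
  rintro b m' ⟨hb, k, hk, rfl⟩
  refine ⟨hb, dataRun_tick m (hk.trans ?_)⟩
  have := R.length_le hm
  unfold coverCost
  gcongr

/-- At a covered feature the greedy action is optimal. -/
theorem Regime.wp_greedy [NeZero A] (R : Regime 𝓛 E p N Emax η) (K : ℕ) {l : List (Fin A)}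
    (hl : l.length < H) {x : Vec d} {m : Machine A d} (hm : LevelOK 𝓛 p.ε Emax η m l.length)
    (hx : m.episode ≤ Emax → ∀ i, |x i - 𝓛.μ l i| ≤ η) :
    wp (greedy p l.length x) m fun b m' =>
      (m.episode ≤ Emax → Covered p.ε (m.feats l.length) x → 𝓛.q l b = 𝓛.v l) ∧
        DataRun H K (greedyCost A d N) m m' := by
  have hN := R.length_le hm
  refine (EQDP.wp_greedy R.lam l.length x m hm.fst_eq).mono ?_
  rintro b m' ⟨hb, k, hk, rfl⟩
  refine ⟨fun he hc => ?_, dataRun_tick m (hk.trans ?_)⟩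
  swap
  · unfold greedyCost; gcongr
  have hζ : 0 ≤ targetError H d Θ η := by
    have := R.Θ_nonneg; have := R.η_pos.le; unfold targetError; positivity
  -- The regression error at x plus dΘη, the price of replacing the mean feature by x; `R.precise`
  -- keeps the sum below half the gap.
  have key : ∀ a, |(invG (m.feats l.length)).mulVec (momentSum (m.pairs a l.length)) ⬝ᵥ x -
      𝓛.q l a| < Δ / 2 := by
    intro a
    have h1 := ridge_error (hm.fst_eq a) (𝓛.θ a l.length) x R.ε_pos.le R.Θ_nonneg
      (𝓛.θ_le a _ hl) hm.norm_le (hm.acc he hl a) hc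
    have h2 : |𝓛.θ a l.length ⬝ᵥ (x - 𝓛.μ l)| ≤ d * Θ * η :=
      abs_dot_le R.Θ_nonneg (𝓛.θ_le a _ hl) (hx he)
    rw [dotProduct_sub, ← 𝓛.lin l a hl] at h2
    have h3 : ((m.feats l.length).length : ℝ) * (targetError H d Θ η * p.ε) ≤
        N * (targetError H d Θ η * p.ε) := by
      have := R.ε_pos.le
      gcongr
    refine lt_of_le_of_lt ?_ R.precise
    exact (abs_sub_le _ (𝓛.θ a l.length ⬝ᵥ x) _).trans (by linarith)
  obtain ⟨a, ha⟩ := 𝓛.exists_q_eq l hl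
  have h1 := abs_lt.1 (key a)
  have h2 := abs_lt.1 (key b)
  have h3 := hb a
  -- A suboptimal b would lose at least Δ, but two prediction errors below Δ/2 cannot make it beat
  -- an optimal action.
  by_contra hne
  have h4 : 0 < 𝓛.v l - 𝓛.q l b := by
    have := lt_of_le_of_ne (𝓛.q_le l b hl) hne
    linarith
  have := 𝓛.gap l b hl h4
  linarith [h1.1, h2.2]

end Analysis

/-! ### Exploration and the value subroutine. -/

section Analysis

variable {H A d : ℕ} {Θ Δ : ℝ} {𝓛 : SeqModel H A d Θ Δ} {E : Env A d} {p : Params}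
  {N Emax : ℕ} {η ε : ℝ}

theorem wp_storePair_bind {α : Type} {a : Fin A} {h : ℕ} {x : Vec d} {y : ℝ}
    {f : Unit → Prog A d α} {m : Machine A d} {Q : α → Machine A d → Prop}
    (H : wp (f ()) { m with
      pairs := Function.update m.pairs a
        (Function.update (m.pairs a) h ((x, y) :: m.pairs a h)) } Q) :
    wp (storePair a h x y >>= f) m Q := H

theorem wp_storeFeat_bind {α : Type} {h : ℕ} {x : Vec d}
    {f : Unit → Prog A d α} {m : Machine A d} {Q : α → Machine A d → Prop}
    (H : wp (f ()) { m with feats := Function.update m.feats h (x :: m.feats h) } Q) :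
    wp (storeFeat h x >>= f) m Q := H

theorem wp_add_bind {α : Type} {x y : ℝ}
    {f : ℝ → Prog A d α} {m : Machine A d} {Q : α → Machine A d → Prop}
    (H : wp (f (x + y)) (m.tick 1) Q) :
    wp (add x y >>= f) m Q := H

theorem dataSize_update {h : ℕ} (hh : h < H) (m : Machine A d) (x : Vec d) :
    dataSize H { m with feats := Function.update m.feats h (x :: m.feats h) } =
      dataSize H m + 1 := by
  have h1 := Finset.sum_erase_add (Finset.range H) (fun j => (m.feats j).length)
    (Finset.mem_range.2 hh)
  have h2 := Finset.sum_erase_add (Finset.range H)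
    (fun j => (Function.update m.feats h (x :: m.feats h) j).length) (Finset.mem_range.2 hh)
  unfold dataSize
  rw [← h1, ← h2, Function.update_self, List.length_cons, ← add_assoc]
  congr 2
  refine Finset.sum_congr rfl fun j hj => ?_
  rw [Function.update_of_ne (Finset.ne_of_mem_erase hj)]

/-- What is required of an estimator of the optimal value after `l`, with `k` steps to go. -/
def ValueSpec (𝓛 : SeqModel H A d Θ Δ) (p : Params) (Emax : ℕ) (η : ℝ) (K c k : ℕ)
    (V : Prog A d ℝ) (l : List (Fin A)) : Prop :=
  ∀ m, Inv 𝓛 p.ε Emax η l.length m → wp V m fun v m' =>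
    Inv 𝓛 p.ε Emax η l.length m' ∧ Frame l.length m m' ∧ Run H K c m m' ∧
      (m'.episode ≤ Emax → |v - 𝓛.v l| ≤ k * η)

/-- The amortized cost is zero: the new data point pays for all A trials, by `hK`. The calls of `V`
only touch datasets of later steps, so at the end x is still uncovered by the dataset it is added
to. -/
theorem Regime.wp_explore (R : Regime 𝓛 E p N Emax η) {K c k : ℕ} {V : List (Fin A) → Prog A d ℝ}
    {l : List (Fin A)} (hl : l.length < H) (hk : k + 1 ≤ H)
    (hV : ∀ a, ValueSpec 𝓛 p Emax η K c k (V (l ++ [a])) (l ++ [a]))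
    (hK : A * (sampleCost H d p.M + c + 1) ≤ K) {x : Vec d} {m : Machine A d}
    (hm : Inv 𝓛 p.ε Emax η l.length m) (hx1 : x ⬝ᵥ x ≤ 1)
    (hx : m.episode ≤ Emax → ∀ i, |x i - 𝓛.μ l i| ≤ η)
    (hc : ¬ Covered p.ε (m.feats l.length) x) :
    wp (explore E p V l x) m fun y m' =>
      Inv 𝓛 p.ε Emax η l.length m' ∧ Frame l.length m m' ∧ Run H K 0 m m' ∧
        dataSize H m + 1 ≤ dataSize H m' ∧
        (m'.episode ≤ Emax → ∀ a, |y a - 𝓛.q l a| ≤ (k + 1 : ℕ) * η) := by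
  set h := l.length with hh
  -- In the loop, step h is misaligned: some of its pair datasets already contain x and the feature
  -- dataset does not. So the invariant is kept from h + 1 on, and step h is described explicitly
  -- relative to m.
  set J : ℕ → (Fin A → ℝ) → Machine A d → Prop := fun i y m' =>
    Inv 𝓛 p.ε Emax η (h + 1) m' ∧ Run H K (i * (sampleCost H d p.M + c + 1)) m m' ∧
    (∀ j, j < h + 1 → m'.feats j = m.feats j) ∧
    (∀ j, j < h → ∀ a, m'.pairs a j = m.pairs a j) ∧
    (∀ a : Fin A, i ≤ a → m'.pairs a h = m.pairs a h) ∧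
    (∀ a : Fin A, (a : ℕ) < i → m'.pairs a h = (x, y a) :: m.pairs a h) ∧
    (m'.episode ≤ Emax → ∀ a : Fin A, (a : ℕ) < i → |y a - 𝓛.q l a| ≤ (k + 1 : ℕ) * η) with hJ
  refine wp_bind ((wp_tabulate J ?_ (fun _ => 0) m ?_).mono ?_)
  · rintro i y m1 ⟨inv, run, fe, pa, pge, plt, acc⟩
    refine wp_bind ((R.wp_rewardMean K hl i m1).mono ?_)
    rintro r m2 ⟨dr, hr⟩
    refine wp_bind ((hV i m2 ?_).mono ?_)
    · rw [List.length_append, List.length_singleton, ← hh]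
      exact dr.inv inv
    rintro v m3 ⟨inv3, fr3, run3, hv⟩
    rw [List.length_append, List.length_singleton, ← hh] at inv3 fr3
    refine wp_add_bind (wp_storePair_bind (wp_pure ?_))
    have fr := (dr.frame (h := h + 1)).trans fr3
    have run4 : Run H K ((i + 1) * (sampleCost H d p.M + c + 1)) m (m3.tick 1) :=
      ((run.trans dr.run).trans (run3.trans (run_tick m3 le_rfl))).mono (by
        rw [Nat.add_mul]; omega)
    refine ⟨?_, ⟨run4.1, run4.2, run4.3, run4.4⟩, ?_, ?_, ?_, ?_, ?_⟩
    · intro j hj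
      refine (inv3 j hj).of_eq rfl (fun a => ?_) le_rfl
      by_cases ha : a = i
      · subst ha
        simp only [Function.update_self]
        rw [Function.update_of_ne (by omega)]
        rfl
      · simp only [Function.update_of_ne ha]
        rfl
    · intro j hj
      exact (fr j hj).1.trans (fe j hj)
    · intro j hj a
      have : (m3.tick 1).pairs a j = m.pairs a j :=
        ((fr j (by omega)).2 a).trans (pa j hj a)
      by_cases ha : a = i
      · subst ha
        simp only [Function.update_self]
        rwa [Function.update_of_ne (by omega)]
      · simpa only [Function.update_of_ne ha] using this
    · intro a ha
      have hne : a ≠ i := by rintro rfl; omega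
      simp only [Function.update_of_ne hne]
      exact ((fr h (by omega)).2 a).trans (pge a (by omega))
    · intro a ha
      by_cases hai : a = i
      · subst hai
        simp only [Function.update_self]
        have : (m3.tick 1).pairs a h = m.pairs a h :=
          ((fr h (by omega)).2 a).trans (pge a le_rfl)
        rw [← hh, this, Function.update_self]
      · have : (a : ℕ) < i := by
          have : (a : ℕ) ≠ i := fun h => hai (Fin.ext h)
          omega
        simp only [Function.update_of_ne hai]
        exact ((fr h (by omega)).2 a).trans (plt a this)
    · intro he a ha
      have he3 : m3.episode ≤ Emax := he
      have he2 := run3.episode_le.trans he3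
      by_cases hai : a = i
      · subst hai
        rw [Function.update_self, 𝓛.q_eq l a hl]
        have h1 := hr he2
        have h2 := hv he3
        have : r + v - (𝓛.r l a + 𝓛.v (l ++ [a])) = (r - 𝓛.r l a) + (v - 𝓛.v (l ++ [a])) := by
          ring
        rw [this]
        push_cast
        exact (abs_add_le _ _).trans (by linarith)
      · have : (a : ℕ) < i := by
          have : (a : ℕ) ≠ i := fun h => hai (Fin.ext h)
          omega
        rw [Function.update_of_ne hai]
        exact acc (dr.run.episode_le.trans he2) a this
  · refine ⟨hm.mono (Nat.le_succ _), ⟨le_rfl, le_rfl, le_rfl, by omega⟩, fun _ _ => rfl,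
      fun _ _ _ => rfl, fun _ _ => rfl, fun a ha => absurd ha (Nat.not_lt_zero _),
      fun _ a ha => absurd ha (Nat.not_lt_zero _)⟩
  · rintro y m1 ⟨inv, run, fe, pa, -, plt, acc⟩
    refine wp_storeFeat_bind (wp_pure ?_)
    have hds := dataSize_update (A := A) hl m1 x
    rw [← hh]
    refine ⟨?_, ?_, ?_, ?_, ?_⟩
    · intro j hj
      rcases hj.eq_or_lt with rfl | hj
      · have ok := hm h le_rfl
        constructor
        · intro a
          simp only [Function.update_self]
          rw [plt a a.2, List.map_cons, ok.fst_eq, fe h (by omega)]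
        · simp only [Function.update_self]
          rw [fe h (by omega)]
          intro z hz
          rcases List.mem_cons.1 hz with rfl | hz
          · exact hx1
          · exact ok.norm_le z hz
        · simp only [Function.update_self]
          rw [fe h (by omega)]
          have h1 := ok.trace_le
          have h2 := trace_invG_cons_le R.ε_pos R.ε_le x (m.feats h) hx1 (not_le.1 hc)
          push_cast [List.length_cons]
          linarith
        · intro he hj a z hz
          have he1 : m1.episode ≤ Emax := he
          have he0 := run.episode_le.trans he1
          rw [show _ = _ from plt a a.2] at hz
          rcases List.mem_cons.1 hz with rfl | hz
          · have h1 := acc he1 a a.2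
            -- The target is within Hη of q, and q = θ·μ is within dΘη of θ·x; the sum is
            -- `targetError`.
            have h2 : |𝓛.θ a h ⬝ᵥ (x - 𝓛.μ l)| ≤ d * Θ * η :=
              abs_dot_le R.Θ_nonneg (𝓛.θ_le a _ hl) (hx he0)
            rw [dotProduct_sub, ← 𝓛.lin l a hl] at h2
            have h3 : ((k + 1 : ℕ) : ℝ) * η ≤ H * η := by
              have := R.η_pos.le
              gcongr
            unfold targetError
            rw [abs_sub_comm] at h2
            refine (abs_sub_le _ (𝓛.q l a) _).trans ?_
            linarith
          · exact ok.acc he0 hj a z hz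
      · refine (inv j hj).of_eq ?_ (fun a => rfl) le_rfl
        simp only
        rw [Function.update_of_ne (by omega)]
    · intro j hj
      refine ⟨?_, pa j hj⟩
      simp only
      rw [Function.update_of_ne (by omega)]
      exact fe j (by omega)
    · refine ⟨run.1, run.2, ?_, ?_⟩
      · rw [hds]; exact run.3.trans (Nat.le_succ _)
      · rw [hds]
        have := run.4
        have : m1.steps + K * dataSize H m ≤ m.steps + 0 + K * (dataSize H m1 + 1) := by
          rw [Nat.mul_succ]; omega
        exact this
    · rw [hds]
      exact Nat.succ_le_succ run.3
    · intro he a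
      exact acc he a a.2

/-- Bound for the cost of one call of the value subroutine, apart from further calls. -/
def nodeCost (H A d M N : ℕ) : ℕ :=
  2 * sampleCost H d M + coverCost d N + greedyCost A d N + A * sampleCost H d M + A + 1

/-- Bound for the cost of a new data point. -/
def pointCost (H A d M N : ℕ) : ℕ :=
  A * (sampleCost H d M + nodeCost H A d M N * H + 1)

/-- The maximum is 1-Lipschitz in the sup norm, so exploring does not amplify errors. -/
theorem abs_max_sub_le (𝓛 : SeqModel H A d Θ Δ) {l : List (Fin A)} (hl : l.length < H)
    {y : Fin A → ℝ} {c : ℝ} {b : Fin A} (hy : ∀ a, |y a - 𝓛.q l a| ≤ c) (hb : ∀ a, y a ≤ y b) :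
    |y b - 𝓛.v l| ≤ c := by
  obtain ⟨a, ha⟩ := 𝓛.exists_q_eq l hl
  have h1 := abs_le.1 (hy a)
  have h2 := abs_le.1 (hy b)
  rw [abs_le]
  constructor
  · linarith [hb a]
  · linarith [𝓛.q_le l b hl]

/-- Each step adds one reward error η, and nothing else: at a covered feature the chosen action is
exactly optimal, otherwise all actions are tried. The amortized cost is linear in k because a
covered step makes one recursive call and the several calls of an uncovered step are charged to its
data point. -/
theorem Regime.computeV_spec [NeZero A] (R : Regime 𝓛 E p N Emax η) (k : ℕ) (l : List (Fin A))
    (hl : l.length + k = H) :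
    ValueSpec 𝓛 p Emax η (pointCost H A d p.M N) (nodeCost H A d p.M N * k) k
      (computeV E p k l) l := by
  set K := pointCost H A d p.M N with hK
  set C := nodeCost H A d p.M N with hC
  induction k generalizing l with
  | zero =>
    intro m hm
    refine wp_pure ⟨hm, fun _ _ => ⟨rfl, fun _ => rfl⟩, run_tick (k := 0) m le_rfl, fun _ => ?_⟩
    rw [𝓛.v_end l (by omega)]
    simp
  | succ k ih =>
    intro m hm
    cases k with
    | zero =>
      have hl' : l.length < H := by omega
      set J : ℕ → (Fin A → ℝ) → Machine A d → Prop := fun i y m' =>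
        DataRun H K (i * sampleCost H d p.M) m m' ∧
          (m'.episode ≤ Emax → ∀ a : Fin A, (a : ℕ) < i → |y a - 𝓛.q l a| ≤ η) with hJ
      refine wp_bind ((wp_tabulate J ?_ (fun _ => 0) m ?_).mono ?_)
      · rintro i y m1 ⟨dr, acc⟩
        refine (R.wp_rewardMean K hl' i m1).mono ?_
        rintro r m2 ⟨dr2, hr⟩
        refine ⟨(dr.trans dr2).mono (by rw [Nat.add_mul]; omega), fun he a ha => ?_⟩
        by_cases hai : a = i
        · subst hai
          rw [Function.update_self, 𝓛.q_eq l a hl', 𝓛.v_end _ (by simp; omega), add_zero]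
          exact hr he
        · have : (a : ℕ) < i := by
            have : (a : ℕ) ≠ i := fun h => hai (Fin.ext h)
            omega
          rw [Function.update_of_ne hai]
          exact acc (dr2.run.episode_le.trans he) a this
      · exact ⟨dataRun_tick (k := 0) m (Nat.zero_le _), fun _ a ha => absurd ha (Nat.not_lt_zero _)⟩
      · rintro y m1 ⟨dr, acc⟩
        refine wp_bind ((wp_argmax y m1).mono ?_)
        rintro b m2 ⟨hb, j, hj, rfl⟩
        have dr2 := dr.trans (dataRun_tick (H := H) (K := K) m1 hj)
        refine wp_pure ⟨dr2.inv hm, dr2.frame, dr2.run.mono ?_, fun he => ?_⟩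
        · rw [hC]; unfold nodeCost; omega
        · simpa using abs_max_sub_le 𝓛 hl' (fun a => acc he a a.2) hb
    | succ k =>
      have hl' : l.length < H := by omega
      refine wp_bind ((R.wp_featureMean K hl' m).mono ?_)
      rintro x m1 ⟨dr1, hx1, hx⟩
      have inv1 := dr1.inv hm
      refine wp_bind ((R.wp_covered K x (inv1 _ le_rfl)).mono ?_)
      rintro b m2 ⟨hb, dr2⟩
      have dr12 := dr1.trans dr2
      have inv2 := dr12.inv hm
      have hx2 : m2.episode ≤ Emax → ∀ i, |x i - 𝓛.μ l i| ≤ η :=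
        fun he => hx (dr2.run.episode_le.trans he)
      have hCle : nodeCost H A d p.M N = C := rfl
      unfold nodeCost at hCle
      by_cases hbt : b = true
      · subst hbt
        rw [if_pos rfl]
        refine wp_bind ((R.wp_greedy K hl' (inv2 _ le_rfl) hx2).mono ?_)
        rintro a m3 ⟨ha, dr3⟩
        refine wp_bind ((R.wp_rewardMean K hl' a m3).mono ?_)
        rintro r m4 ⟨dr4, hr⟩
        have dr := dr12.trans (dr3.trans dr4)
        have inv4 := dr.inv hm
        have ihl := ih (l ++ [a]) (by simp; omega)
        refine wp_bind ((ihl m4 (inv4.mono (by simp))).mono ?_)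
        rintro v m5 ⟨inv5, fr5, run5, hv⟩
        rw [List.length_append, List.length_singleton] at inv5 fr5
        -- The recursive call restores the invariant only for later steps; the current step is
        -- untouched by the frame property.
        have inv5' : Inv 𝓛 p.ε Emax η l.length m5 := by
          intro j hj
          rcases hj.eq_or_lt with rfl | hj
          · exact (inv4 _ le_rfl).of_eq (fr5 _ (Nat.lt_succ_self _)).1
              (fr5 _ (Nat.lt_succ_self _)).2 run5.episode_le
          · exact inv5 j hj
        have dr6 : DataRun H K 1 m5 (m5.tick 1) := dataRun_tick m5 le_rfl
        refine ⟨dr6.inv inv5', (dr.frame.trans (fr5.mono (Nat.le_succ _))).trans dr6.frame,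
          ((dr.run.trans run5).trans dr6.run).mono ?_, fun he => ?_⟩
        · rw [Nat.mul_succ C (k + 1)]; omega
        · have he5 : m5.episode ≤ Emax := he
          have he4 := run5.episode_le.trans he5
          have he2 := (dr3.trans dr4).run.episode_le.trans he4
          -- The value is compared with q at the chosen action, which equals v: no regression error
          -- enters.
          have hq := ha he2 (by rw [dr2.feats]; exact hb.1 rfl)
          have h1 := hr he4
          have h2 := hv he5
          change |r + v - _| ≤ _
          rw [← hq, 𝓛.q_eq l a hl']
          have : r + v - (𝓛.r l a + 𝓛.v (l ++ [a])) =
            (r - 𝓛.r l a) + (v - 𝓛.v (l ++ [a])) := by ring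
          rw [this]
          push_cast at h2 ⊢
          exact (abs_add_le _ _).trans (by linarith)
      · rw [if_neg hbt]
        have hnc : ¬ Covered p.ε (m2.feats l.length) x := by
          rw [dr2.feats]; exact fun h => hbt (hb.2 h)
        refine wp_bind ((R.wp_explore (K := K) (c := C * (k + 1)) hl' (by omega)
          (fun a => ih (l ++ [a]) (by simp; omega)) ?_ inv2 hx1 hx2 hnc).mono ?_)
        · rw [hK]
          unfold pointCost
          gcongr
          omega
        rintro y m3 ⟨inv3, fr3, run3, -, acc⟩
        refine wp_bind ((wp_argmax y m3).mono ?_)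
        rintro b m4 ⟨hb, j, hj, rfl⟩
        have dr4 : DataRun H K A m3 (m3.tick j) := dataRun_tick m3 hj
        refine wp_pure ⟨dr4.inv inv3, (dr12.frame.trans fr3).trans dr4.frame,
          ((dr12.run.trans run3).trans dr4.run).mono ?_, fun he => ?_⟩
        · rw [Nat.mul_succ C (k + 1)]; omega
        · exact abs_max_sub_le 𝓛 hl' (acc he) hb

end Analysis

/-! ### The main loop: rounds, termination and total cost. -/

section Analysis

variable {H A d : ℕ} {Θ Δ : ℝ} {𝓛 : SeqModel H A d Θ Δ} {E : Env A d} {p : Params}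
  {N Emax : ℕ} {η ε : ℝ}

/-- The actions `as` played after `l` were chosen at the features `xs`, with datasets `F`, and if
`B` holds, then the features are accurate and the actions at covered features are optimal. -/
inductive Chain (𝓛 : SeqModel H A d Θ Δ) (ε η : ℝ) (F : ℕ → List (Vec d)) (B : Prop) :
    List (Fin A) → List (Fin A) → List (Vec d) → Prop
  | nil (l) : Chain 𝓛 ε η F B l [] []
  | cons (l a as x xs) (hl : l.length < H) (hx1 : x ⬝ᵥ x ≤ 1)
      (hx : B → ∀ i, |x i - 𝓛.μ l i| ≤ η)
      (ha : B → Covered ε (F l.length) x → 𝓛.q l a = 𝓛.v l)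
      (h : Chain 𝓛 ε η F B (l ++ [a]) as xs) : Chain 𝓛 ε η F B l (a :: as) (x :: xs)

/-- Coverage is tested only after the pass, so `Chain` records optimality conditionally on it.
Datasets do not change during the pass, so the later test concerns those the actions were chosen
with. -/
theorem Regime.wp_forward [NeZero A] (R : Regime 𝓛 E p N Emax η) (K k : ℕ) (l : List (Fin A))
    (hl : l.length + k = H) (m : Machine A d) (hm : Inv 𝓛 p.ε Emax η 0 m) :
    wp (forward E p k l) m fun z m' =>
      DataRun H K (k * (sampleCost H d p.M + greedyCost A d N)) m m' ∧
        ∃ as, z.1 = l ++ as ∧ as.length = k ∧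
          Chain 𝓛 p.ε η m'.feats (m'.episode ≤ Emax) l as z.2 := by
  induction k generalizing l m with
  | zero => exact ⟨dataRun_tick (k := 0) m (Nat.zero_le _), [], by simp; rfl, rfl, Chain.nil l⟩
  | succ k ih =>
    have hl' : l.length < H := by omega
    refine wp_bind ((R.wp_featureMean K hl' m).mono ?_)
    rintro x m1 ⟨dr1, hx1, hx⟩
    have inv1 := dr1.inv hm
    refine wp_bind ((R.wp_greedy K hl' (inv1 _ (Nat.zero_le _)) hx).mono ?_)
    rintro a m2 ⟨ha, dr2⟩
    refine wp_bind ((ih (l ++ [a]) (by simp; omega) m2 (dr2.inv inv1)).mono ?_)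
    rintro z m3 ⟨dr3, as, hz, has, hch⟩
    refine wp_pure ⟨((dr1.trans dr2).trans dr3).mono (by rw [Nat.add_mul]; omega), a :: as,
      by simp [hz], by simp [has], ?_⟩
    have he1 : m3.episode ≤ Emax → m1.episode ≤ Emax := fun h =>
      (dr2.trans dr3).run.episode_le.trans h
    refine Chain.cons l a as x z.2 hl' hx1 (fun h => hx (he1 h)) (fun h hc => ?_) hch
    refine ha (he1 h) ?_
    rwa [(dr2.trans dr3).feats] at hc

/-- All actions `as` played after `l` are optimal. -/
def OptFrom (𝓛 : SeqModel H A d Θ Δ) : List (Fin A) → List (Fin A) → Prop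
  | _, [] => True
  | l, a :: as => 𝓛.q l a = 𝓛.v l ∧ OptFrom 𝓛 (l ++ [a]) as

/-- If all tests succeed, every conditional optimality in the chain applies. Otherwise the uncovered
feature comes with the prefix of actions at which it was estimated, as exploration needs. -/
theorem Regime.wp_firstUncovered (R : Regime 𝓛 E p N Emax η) (K : ℕ) {F : ℕ → List (Vec d)}
    {B : Prop} {l as : List (Fin A)} {xs : List (Vec d)} (hch : Chain 𝓛 p.ε η F B l as xs)
    (m : Machine A d) (hm : Inv 𝓛 p.ε Emax η 0 m) (hF : m.feats = F) :
    wp (firstUncovered p l.length xs) m fun u m' =>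
      DataRun H K (as.length * coverCost d N) m m' ∧
        (u = none → B → OptFrom 𝓛 l as) ∧
        ∀ j x, u = some (j, x) → ∃ l₁ l₂, l ++ as = l₁ ++ l₂ ∧ l₁.length = j ∧ j < H ∧
          x ⬝ᵥ x ≤ 1 ∧ (B → ∀ i, |x i - 𝓛.μ l₁ i| ≤ η) ∧ ¬ Covered p.ε (F j) x := by
  induction hch generalizing m with
  | nil l =>
    exact ⟨dataRun_tick (k := 0) m (Nat.zero_le _), fun _ _ => trivial, fun j x h => by cases h⟩
  | cons l a as x xs hl hx1 hx ha h ih =>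
    refine wp_bind ((R.wp_covered K x (hm _ (Nat.zero_le _))).mono ?_)
    rintro b m1 ⟨hb, dr1⟩
    by_cases hbt : b = true
    · rw [if_pos hbt]
      have ih' := ih m1 (dr1.inv hm) (dr1.feats.trans hF)
      rw [List.length_append, List.length_singleton] at ih'
      refine ih'.mono ?_
      rintro u m2 ⟨dr2, h1, h2⟩
      refine ⟨(dr1.trans dr2).mono (by rw [List.length_cons, Nat.add_mul]; omega),
        fun hu hB => ⟨ha hB ?_, h1 hu hB⟩, fun j y hu => ?_⟩
      · rw [← hF]; exact hb.1 hbt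
      · obtain ⟨l₁, l₂, e, rest⟩ := h2 j y hu
        exact ⟨l₁, l₂, by rw [← e]; simp, rest⟩
    · rw [if_neg hbt]
      refine wp_pure ⟨dr1.mono (by rw [List.length_cons, Nat.add_mul]; omega), fun hu => (by cases hu),
        fun j y hu => ?_⟩
      cases hu
      exact ⟨l, a :: as, rfl, rfl, hl, hx1, hx, fun hc => hbt (hb.2 (by rw [hF]; exact hc))⟩

/-- Bound for the cost of a round, apart from the exploration. -/
def roundCost (H A d M N : ℕ) : ℕ :=
  H * (sampleCost H d M + greedyCost A d N) + H * coverCost d N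

theorem Regime.wp_round [NeZero A] (R : Regime 𝓛 E p N Emax η) (m : Machine A d)
    (hm : Inv 𝓛 p.ε Emax η 0 m) :
    wp (round E p H) m fun u m' =>
      Inv 𝓛 p.ε Emax η 0 m' ∧ Run H (pointCost H A d p.M N) (roundCost H A d p.M N) m m' ∧
        (u = none → dataSize H m + 1 ≤ dataSize H m') ∧
        ∀ l, u = some l → l.length = H ∧ (m'.episode ≤ Emax → OptFrom 𝓛 [] l) := by
  set K := pointCost H A d p.M N with hK
  refine wp_bind ((R.wp_forward K H [] (by simp) m hm).mono ?_)
  rintro ⟨z1, z2⟩ m1 ⟨dr1, as, hz, has, hch⟩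
  simp only [List.nil_append] at hz hch
  subst hz
  have inv1 := dr1.inv hm
  refine wp_bind ((R.wp_firstUncovered K hch m1 inv1 rfl).mono ?_)
  rintro u m2 ⟨dr2, h1, h2⟩
  have dr12 := dr1.trans dr2
  have inv2 := dr2.inv inv1
  rw [has] at dr12
  rcases u with _ | ⟨j, x⟩
  · refine wp_pure ⟨inv2, dr12.run, fun hu => (by cases hu), fun l hu => ?_⟩
    cases hu
    exact ⟨has, fun he => h1 rfl (dr2.run.episode_le.trans he)⟩
  · obtain ⟨l₁, l₂, e, hl₁, hj, hx1, hx, hc⟩ := h2 j x rfl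
    have htake : z1.take j = l₁ := by
      rw [show z1 = l₁ ++ l₂ from e, ← hl₁, List.take_left]
    refine wp_bind (p := explore E p (computeV E p (H - (j + 1))) (z1.take j) x) ?_
    rw [htake]
    refine (R.wp_explore (K := K) (c := nodeCost H A d p.M N * (H - (j + 1))) (l := l₁)
      (by omega) (k := H - (j + 1)) (by omega)
      (fun a => R.computeV_spec _ (l₁ ++ [a]) (by simp; omega)) ?_ (inv2.mono (Nat.zero_le _)) hx1
      (fun he => hx (dr2.run.episode_le.trans he)) ?_).mono ?_
    · rw [hK]
      unfold pointCost
      gcongr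
      omega
    · rw [dr2.feats, hl₁]; exact hc
    · rintro y m3 ⟨inv3, fr3, run3, hs, -⟩
      refine wp_pure ⟨fun i _ => ?_, (dr12.run.trans run3).mono le_rfl, fun _ => ?_,
        fun l hu => by cases hu⟩
      · by_cases hi : l₁.length ≤ i
        · exact inv3 i hi
        · exact (inv2 i (Nat.zero_le _)).of_eq (fr3 i (by omega)).1 (fr3 i (by omega)).2
            run3.episode_le
      · exact (Nat.succ_le_succ dr12.run.size_le).trans hs

/-- Every round but the last creates a data point, and the number of data points is at most HN, so
`hn` leaves enough fuel. Each data point now also pays for its round; only the last round remains as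
amortized cost. -/
theorem Regime.wp_rounds [NeZero A] (R : Regime 𝓛 E p N Emax η) (n : ℕ) (m : Machine A d)
    (hm : Inv 𝓛 p.ε Emax η 0 m) (hn : H * N + 1 ≤ n + dataSize H m) :
    wp (rounds E p H n) m fun u m' =>
      ∃ l, u = some l ∧ l.length = H ∧ (m'.episode ≤ Emax → OptFrom 𝓛 [] l) ∧
        Inv 𝓛 p.ε Emax η 0 m' ∧
        Run H (pointCost H A d p.M N + roundCost H A d p.M N) (roundCost H A d p.M N) m m' := by
  induction n generalizing m with
  | zero =>
    have := R.dataSize_le hm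
    omega
  | succ n ih =>
    refine wp_bind ((R.wp_round m hm).mono ?_)
    rintro u m1 ⟨inv1, run1, h1, h2⟩
    have hc := run1.cost
    have hs := run1.size_le
    rcases u with _ | l
    · have h3 := h1 rfl
      refine (ih m1 inv1 (by omega)).mono ?_
      rintro u m2 ⟨l, rfl, hl, hopt, inv2, run2⟩
      refine ⟨l, rfl, hl, hopt, inv2, run1.episode_le.trans run2.episode_le, ?_,
        run1.size_le.trans run2.size_le, ?_⟩
      · have := run1.episode_steps; have := run2.episode_steps; omega
      · have := run2.cost
        have h4 := Nat.mul_le_mul_left (roundCost H A d p.M N) h3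
        rw [Nat.mul_succ] at h4
        rw [Nat.add_mul] at *
        rw [Nat.add_mul] at *
        omega
    · refine wp_pure ⟨l, rfl, (h2 l rfl).1, (h2 l rfl).2, inv1, run1.episode_le,
        run1.episode_steps, run1.size_le, ?_⟩
      have h4 := Nat.mul_le_mul_left (roundCost H A d p.M N) hs
      rw [Nat.add_mul, Nat.add_mul]
      omega

/-- Bound for the total cost. -/
def totalCost (H A d M N : ℕ) : ℕ :=
  roundCost H A d M N + (pointCost H A d M N + roundCost H A d M N) * (H * N)

/-- Each episode costs at least one operation, so the total cost also bounds the number of episodes.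
Only correctness needs `Emax` to be that large. -/
theorem Regime.terminates [NeZero A] (R : Regime 𝓛 E p N Emax η) :
    ∃ l c, Terminates E p H l c ∧ c ≤ totalCost H A d p.M N ∧
      (totalCost H A d p.M N ≤ Emax → l.length = H ∧ OptFrom 𝓛 [] l) := by
  have inv0 : Inv 𝓛 p.ε Emax η 0 (Machine.start A d) := fun j _ =>
    { fst_eq := fun a => rfl
      norm_le := fun x hx => by cases hx
      trace_le := by
        change (invG []).trace + (0 : ℕ) * _ ≤ (d : ℝ)
        rw [trace_invG_nil]; simp
      acc := fun _ _ a z hz => by cases hz }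
  obtain ⟨l, hl, hlen, hopt, inv, run⟩ := R.wp_rounds (H * N + 1) (Machine.start A d) inv0
    (Nat.le_add_right _ _)
  set m' := ((rounds E p H (H * N + 1)).run (Machine.start A d)).2 with hm'
  have hsteps : m'.steps ≤ totalCost H A d p.M N := by
    have h1 := run.cost
    have h2 := R.dataSize_le inv
    have h0 : (Machine.start A d).steps = 0 := rfl
    unfold totalCost
    have h3 := Nat.mul_le_mul_left (pointCost H A d p.M N + roundCost H A d p.M N) h2
    omega
  refine ⟨l, m'.steps, ⟨_, hl, rfl⟩, hsteps, fun hE => ⟨hlen, hopt ?_⟩⟩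
  have h1 := run.episode_steps
  have h2 : (Machine.start A d).episode = 0 := rfl
  omega

end Analysis

/-! ### Optimal values of the model and its description by action sequences. -/

namespace DetPOMDP

variable {S : Type*} {O : Type*} [MeasurableSpace O] {A : ℕ} (𝓜 : DetPOMDP S O A)

theorem latentFrom_append (h : ℕ) (s : S) (l : List (Fin A)) (a : Fin A) :
    𝓜.latentFrom h s (l ++ [a]) = 𝓜.next (h + l.length) (𝓜.latentFrom h s l) a := by
  induction l generalizing h s with
  | nil => rfl
  | cons b l ih =>
    simp only [List.cons_append, latentFrom, ih, List.length_cons]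
    rw [show h + 1 + l.length = h + (l.length + 1) by omega]

theorem latent_append (l : List (Fin A)) (a : Fin A) :
    𝓜.latent (l ++ [a]) = 𝓜.next l.length (𝓜.latent l) a := by
  rw [latent, latentFrom_append, Nat.zero_add]; rfl

theorem integrable_reward (h : ℕ) (s : S) (a : Fin A) :
    Integrable (fun x : ℝ => x) (𝓜.reward h s a) :=
  Integrable.of_mem_Icc 0 1 measurable_id.aemeasurable (𝓜.reward_mem h s a)

theorem meanReward_nonneg (h : ℕ) (s : S) (a : Fin A) : 0 ≤ 𝓜.meanReward h s a := by
  refine integral_nonneg_of_ae ?_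
  filter_upwards [𝓜.reward_mem h s a] with x hx using hx.1

theorem sum_pmf_toReal (μ : PMF (Fin A)) : ∑ a, (μ a).toReal = 1 := by
  rw [← ENNReal.toReal_sum fun a _ => μ.apply_ne_top a, ← tsum_fintype (L := .unconditional _),
    μ.tsum_coe, ENNReal.toReal_one]

variable [NeZero A]

theorem Vstar_eq_sup {H h : ℕ} (hh : h < H) (s : S) :
    𝓜.Vstar H h s = Finset.univ.sup' Finset.univ_nonempty fun a => 𝓜.Qstar H h s a := by
  unfold Vstar Qstar Vstar
  rw [show H - h = (H - (h + 1)) + 1 by omega]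
  rfl

theorem optValue_nonneg (k h : ℕ) (s : S) : 0 ≤ 𝓜.optValue k h s := by
  induction k generalizing h s with
  | zero => exact le_rfl
  | succ k ih =>
    refine le_trans ?_ (Finset.le_sup' _ (Finset.mem_univ (0 : Fin A)))
    exact add_nonneg (𝓜.meanReward_nonneg _ _ _) (ih _ _)

/-- No policy does better than the optimal latent value. -/
theorem valueFrom_le (π : Policy O A) (k h : ℕ) (s : S) (hist : List (O × Fin A × ℝ)) :
    𝓜.valueFrom π k h s hist ≤ 𝓜.optValue k h s := by
  induction k generalizing h s hist with
  | zero => exact le_rfl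
  | succ k ih =>
    have h1 : ∀ o a, ∫ x, (x + 𝓜.valueFrom π k (h + 1) (𝓜.next h s a) (hist ++ [(o, a, x)]))
        ∂(𝓜.reward h s a) ≤ 𝓜.optValue (k + 1) h s := by
      intro o a
      have h2 : 𝓜.meanReward h s a + 𝓜.optValue k (h + 1) (𝓜.next h s a) ≤
          𝓜.optValue (k + 1) h s :=
        Finset.le_sup' (fun a => 𝓜.meanReward h s a + 𝓜.optValue k (h + 1) (𝓜.next h s a))
          (Finset.mem_univ a)
      by_cases hi : Integrable (fun x => x + 𝓜.valueFrom π k (h + 1) (𝓜.next h s a)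
          (hist ++ [(o, a, x)])) (𝓜.reward h s a)
      · refine le_trans ?_ h2
        refine (integral_mono hi ((𝓜.integrable_reward h s a).add (integrable_const
          (𝓜.optValue k (h + 1) (𝓜.next h s a)))) fun x => ?_).trans ?_
        · exact add_le_add_right (ih _ _ _) x
        · change ∫ x, (x + 𝓜.optValue k (h + 1) (𝓜.next h s a)) ∂(𝓜.reward h s a) ≤ _
          rw [integral_add (𝓜.integrable_reward h s a) (integrable_const _)]
          simp [meanReward]
      -- Policies need not be measurable; a non-integrable inner or outer integral is 0 by
      -- convention, which is harmless as optimal values are nonnegative.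
      · rw [integral_undef hi]
        exact 𝓜.optValue_nonneg _ _ _
    set g : O → ℝ := fun o => ∑ a : Fin A, (π hist o a).toReal *
      ∫ x, (x + 𝓜.valueFrom π k (h + 1) (𝓜.next h s a) (hist ++ [(o, a, x)]))
        ∂(𝓜.reward h s a) with hg
    have h3 : ∀ o, g o ≤ 𝓜.optValue (k + 1) h s := by
      intro o
      calc g o ≤ ∑ a : Fin A, (π hist o a).toReal * 𝓜.optValue (k + 1) h s :=
            Finset.sum_le_sum fun a _ => mul_le_mul_of_nonneg_left (h1 o a) ENNReal.toReal_nonneg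
        _ = _ := by rw [← Finset.sum_mul, sum_pmf_toReal, one_mul]
    change ∫ o, g o ∂(𝓜.emission h s) ≤ _
    by_cases hi : Integrable g (𝓜.emission h s)
    · refine (integral_mono hi (integrable_const _) h3).trans ?_
      simp
    · rw [integral_undef hi]
      exact 𝓜.optValue_nonneg _ _ _

/-- `𝓛` describes the model `𝓜`. -/
structure Describes {H d : ℕ} {Θ Δ : ℝ} (ψ : O → EuclideanSpace ℝ (Fin d))
    (𝓛 : SeqModel H A d Θ Δ) : Prop where
  r_eq : ∀ l a, 𝓛.r l a = 𝓜.meanReward l.length (𝓜.latent l) a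
  v_eq : ∀ l, 𝓛.v l = 𝓜.Vstar H l.length (𝓜.latent l)
  μ_eq : ∀ l, 𝓛.μ l = (∫ o, ψ o ∂(𝓜.emission l.length (𝓜.latent l))).ofLp

variable {𝓜}

/-- The continuation value does not depend on the recorded observation and reward, so every
integrand is a constant or a constant plus the reward. `hh` is needed because the open-loop policy
reads its position off the length of the history. -/
theorem valueFrom_openLoop {H d : ℕ} {Θ Δ : ℝ} {ψ : O → EuclideanSpace ℝ (Fin d)}
    {𝓛 : SeqModel H A d Θ Δ} (hd : 𝓜.Describes ψ 𝓛) (l₁ l₂ : List (Fin A))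
    (hl : l₁.length + l₂.length = H) (hopt : OptFrom 𝓛 l₁ l₂) (hist : List (O × Fin A × ℝ))
    (hh : hist.length = l₁.length) :
    𝓜.valueFrom (openLoop (l₁ ++ l₂)) l₂.length l₁.length (𝓜.latent l₁) hist = 𝓛.v l₁ := by
  induction l₂ generalizing l₁ hist with
  | nil => rw [𝓛.v_end l₁ (by simpa using hl)]; rfl
  | cons a l₂ ih =>
    have hl' : l₁.length < H := by rw [← hl, List.length_cons]; omega
    have hget : ∀ o : O, openLoop (l₁ ++ a :: l₂) hist o = PMF.pure a := by
      intro o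
      simp [openLoop, hh]
    have h1 : ∀ (o : O) (x : ℝ), 𝓜.valueFrom (openLoop (l₁ ++ a :: l₂)) l₂.length
        (l₁.length + 1) (𝓜.next l₁.length (𝓜.latent l₁) a) (hist ++ [(o, a, x)]) =
        𝓛.v (l₁ ++ [a]) := by
      intro o x
      have := ih (l₁ ++ [a]) (by rw [← hl]; simp; omega) hopt.2 (hist ++ [(o, a, x)])
        (by simp [hh])
      rw [latent_append] at this
      simpa using this
    have h2 : ∀ o : O, (∑ a' : Fin A, (openLoop (l₁ ++ a :: l₂) hist o a').toReal *
        ∫ x, (x + 𝓜.valueFrom (openLoop (l₁ ++ a :: l₂)) l₂.length (l₁.length + 1)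
          (𝓜.next l₁.length (𝓜.latent l₁) a') (hist ++ [(o, a', x)]))
          ∂(𝓜.reward l₁.length (𝓜.latent l₁) a')) = 𝓛.v l₁ := by
      intro o
      rw [Finset.sum_eq_single a]
      · rw [hget, PMF.pure_apply, if_pos rfl, ENNReal.toReal_one, one_mul]
        simp only [h1]
        rw [integral_add (𝓜.integrable_reward _ _ a) (integrable_const _), ← hopt.1,
          𝓛.q_eq _ _ hl', hd.r_eq]
        simp [meanReward]
      · intro b _ hb
        rw [hget, PMF.pure_apply, if_neg hb]
        simp
      · simp
    rw [List.length_cons]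
    change ∫ o, _ ∂(𝓜.emission l₁.length (𝓜.latent l₁)) = _
    simp only [h2]
    simp

theorem isOptimalSeq {H d : ℕ} {Θ Δ : ℝ} {ψ : O → EuclideanSpace ℝ (Fin d)}
    {𝓛 : SeqModel H A d Θ Δ} (hd : 𝓜.Describes ψ 𝓛) {l : List (Fin A)} (hl : l.length = H)
    (hopt : OptFrom 𝓛 [] l) : 𝓜.IsOptimalSeq H l := by
  refine ⟨hl, fun π => ?_⟩
  have h1 := valueFrom_openLoop hd [] l (by simpa using hl) hopt [] rfl
  rw [hl, hd.v_eq] at h1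
  have h2 : 𝓜.value H (openLoop l) = 𝓜.Vstar H 0 𝓜.init := h1
  rw [h2]
  exact 𝓜.valueFrom_le π H 0 𝓜.init []

/-- The weights come from `exists_lift` at each step; the minimum over finitely many positive
singular values is positive and gives one bound Θ. The signs of Θ and d are returned to dispose of
inputs that no model realizes. -/
theorem exists_describes {H d dₛ : ℕ} {Δ W Θ : ℝ} (hH : 0 < H)
    {ψ : O → EuclideanSpace ℝ (Fin d)} {φ : S → EuclideanSpace ℝ (Fin dₛ)}
    {G : Fin H → Matrix (Fin d) (Fin dₛ) ℝ} (hdₛ : 0 < dₛ)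
    (hG : 𝓜.IsMeanEmbedding H ψ φ G) (hQ : 𝓜.LinearQstar H φ W) (hgap : 𝓜.HasGap H Δ)
    (hΘ : Θ = W / (⨅ h : Fin H, minSingularValue (G h))) :
    0 ≤ Θ ∧ 0 < d ∧ ∃ 𝓛 : SeqModel H A d Θ Δ, 𝓜.Describes ψ 𝓛 := by
  have : Nonempty (Fin H) := ⟨⟨0, hH⟩⟩
  obtain ⟨w0, hw0, -⟩ := hQ 0 hH 0
  have hW : 0 ≤ W := (norm_nonneg _).trans hw0
  have hpos : 0 < ⨅ h : Fin H, minSingularValue (G h) := by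
    obtain ⟨h, hh⟩ := exists_eq_ciInf_of_finite (f := fun h : Fin H => minSingularValue (G h))
    rw [← hh]
    obtain ⟨L, hL⟩ := (hG h).2
    exact minSingularValue_pos hdₛ hL
  have hd : 0 < d := by
    rcases Nat.eq_zero_or_pos d with rfl | h
    · exfalso
      obtain ⟨L, hL⟩ := (hG ⟨0, hH⟩).2
      have := congrFun (congrFun hL ⟨0, hdₛ⟩) ⟨0, hdₛ⟩
      simp [Matrix.mul_apply] at this
    · exact h
  have hθ : ∀ (a : Fin A) (h : ℕ), ∃ θ : EuclideanSpace ℝ (Fin d), h < H → ‖θ‖ ≤ Θ ∧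
      ∀ s, 𝓜.Qstar H h s a = inner ℝ θ (∫ o, ψ o ∂(𝓜.emission h s)) := by
    intro a h
    by_cases hh : h < H
    · obtain ⟨w, hw, hwq⟩ := hQ h hh a
      obtain ⟨L, hL⟩ := (hG ⟨h, hh⟩).2
      obtain ⟨θ, h1, h2⟩ := exists_lift hdₛ hL w
      refine ⟨θ, fun _ => ⟨h1.trans ?_, fun s => ?_⟩⟩
      · rw [hΘ]
        exact div_le_div₀ hW hw hpos (ciInf_le (Set.finite_range _).bddBelow _)
      · rw [hwq, ← h2, ← (hG ⟨h, hh⟩).1 s]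
    · exact ⟨0, fun h => absurd h hh⟩
  choose θ hθ using hθ
  have hinner : ∀ x y : EuclideanSpace ℝ (Fin d), inner ℝ x y = x.ofLp ⬝ᵥ y.ofLp := by
    intro x y
    rw [EuclideanSpace.inner_eq_star_dotProduct, dotProduct_comm]
    simp
  refine ⟨hΘ ▸ div_nonneg hW hpos.le, hd,
    { r := fun l a => 𝓜.meanReward l.length (𝓜.latent l) a
      q := fun l a => 𝓜.Qstar H l.length (𝓜.latent l) a
      v := fun l => 𝓜.Vstar H l.length (𝓜.latent l)
      μ := fun l => (∫ o, ψ o ∂(𝓜.emission l.length (𝓜.latent l))).ofLp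
      θ := fun a h => (θ a h).ofLp
      q_eq := fun l a _ => by
        rw [latent_append, List.length_append, List.length_singleton]; rfl
      v_end := fun l hl => by rw [hl, Vstar, Nat.sub_self]; rfl
      q_le := fun l a hl => by
        rw [Vstar_eq_sup _ hl]
        exact Finset.le_sup' (fun a => 𝓜.Qstar H l.length (𝓜.latent l) a) (Finset.mem_univ a)
      exists_q_eq := fun l hl => by
        rw [Vstar_eq_sup _ hl]
        obtain ⟨a, -, ha⟩ := Finset.exists_mem_eq_sup' Finset.univ_nonempty
          fun a => 𝓜.Qstar H l.length (𝓜.latent l) a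
        exact ⟨a, ha.symm⟩
      gap := fun l a hl => hgap l.length hl (𝓜.latent l) a
      lin := fun l a hl => by rw [← hinner]; exact (hθ a _ hl).2 _
      θ_le := fun a h hh => by
        rw [← hinner, real_inner_self_eq_norm_sq]
        exact pow_le_pow_left₀ (norm_nonneg _) (hθ a h hh).1 2 },
    ⟨fun _ _ => rfl, fun _ => rfl, fun _ => rfl⟩⟩

end DetPOMDP

/-! ### Concentration and the union bound. -/

open ProbabilityTheory in
theorem hoeffding_ge {ι : Type*} {Ω : ι → Type*} [∀ i, MeasurableSpace (Ω i)]
    (P : ∀ i, Measure (Ω i)) [∀ i, IsProbabilityMeasure (P i)] (X : ∀ i, Ω i → ℝ)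
    (hX : ∀ i, Measurable (X i)) {f : ℕ → ι} (hf : Function.Injective f)
    (hb : ∀ j, ∀ᵐ x ∂(P (f j)), X (f j) x ∈ Set.Icc (-1 : ℝ) 1) {μ : ℝ}
    (hμ : ∀ j, ∫ x, X (f j) x ∂(P (f j)) = μ) {M : ℕ} (hM : 0 < M) {η : ℝ} (hη : 0 ≤ η) :
    Measure.infinitePi P {ω | η ≤ (∑ j ∈ Finset.range M, X (f j) (ω (f j))) / M - μ} ≤
      ENNReal.ofReal (Real.exp (-(M * (η ^ 2 / 2)))) := by
  have hM' : (0 : ℝ) < M := by exact_mod_cast hM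
  set Y : ℕ → (∀ i, Ω i) → ℝ := fun j ω => X (f j) (ω (f j)) - μ with hY
  have hind : iIndepFun Y (Measure.infinitePi P) :=
    ((iIndepFun_infinitePi (P := P) hX).precomp hf).comp (fun _ x => x - μ) fun _ => by fun_prop
  have hsub : ∀ j < M, HasSubgaussianMGF (Y j) 1 (Measure.infinitePi P) := by
    intro j _
    have mp := measurePreserving_eval_infinitePi P (f j)
    have hm : AEMeasurable (fun ω : ∀ i, Ω i => X (f j) (ω (f j))) (Measure.infinitePi P) :=
      ((hX (f j)).comp (measurable_pi_apply (f j))).aemeasurable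
    have h1 := hasSubgaussianMGF_of_mem_Icc hm (mp.quasiMeasurePreserving.ae (hb j))
    have h2 : ∫ ω, X (f j) (ω (f j)) ∂(Measure.infinitePi P) = μ := by
      rw [← hμ j, ← mp.map_eq, integral_map mp.measurable.aemeasurable
        (hX (f j)).aestronglyMeasurable]
    rw [h2] at h1
    -- An interval of length 2 has variance proxy (2/2)² = 1.
    convert h1 using 1
    norm_num
  have := HasSubgaussianMGF.measure_sum_range_ge_le_of_iIndepFun hind hsub (ε := M * η) (by positivity)
  have hset : {ω | η ≤ (∑ j ∈ Finset.range M, X (f j) (ω (f j))) / M - μ} =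
      {ω | (M : ℝ) * η ≤ ∑ j ∈ Finset.range M, Y j ω} := by
    ext ω
    simp only [Set.mem_ofPred_eq, hY, Finset.sum_sub_distrib, Finset.sum_const, Finset.card_range,
      nsmul_eq_mul]
    rw [le_sub_iff_add_le, le_div_iff₀ hM', le_sub_iff_add_le]
    constructor <;> intro h <;> linarith
  rw [hset, ← ENNReal.ofReal_toReal (measure_ne_top _ _)]
  refine ENNReal.ofReal_le_ofReal (this.trans_eq ?_)
  congr 1
  simp
  field_simp

theorem hoeffding_abs {ι : Type*} {Ω : ι → Type*} [∀ i, MeasurableSpace (Ω i)]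
    (P : ∀ i, Measure (Ω i)) [∀ i, IsProbabilityMeasure (P i)] (X : ∀ i, Ω i → ℝ)
    (hX : ∀ i, Measurable (X i)) {f : ℕ → ι} (hf : Function.Injective f)
    (hb : ∀ j, ∀ᵐ x ∂(P (f j)), X (f j) x ∈ Set.Icc (-1 : ℝ) 1) {μ : ℝ}
    (hμ : ∀ j, ∫ x, X (f j) x ∂(P (f j)) = μ) {M : ℕ} (hM : 0 < M) {η : ℝ} (hη : 0 ≤ η) :
    Measure.infinitePi P {ω | η < |(∑ j ∈ Finset.range M, X (f j) (ω (f j))) / M - μ|} ≤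
      ENNReal.ofReal (2 * Real.exp (-(M * (η ^ 2 / 2)))) := by
  have h1 := hoeffding_ge P X hX hf hb hμ hM hη
  have h2 := hoeffding_ge P (fun i x => -X i x) (fun i => (hX i).neg) hf (μ := -μ)
    (fun j => by
      filter_upwards [hb j] with x hx
      exact ⟨by linarith [hx.2], by linarith [hx.1]⟩)
    (fun j => by rw [integral_neg, hμ]) hM hη
  refine (measure_mono (t := _ ∪ _) ?_).trans ((measure_union_le _ _).trans
    ((add_le_add h1 h2).trans_eq ?_))
  · intro ω hω
    rcases lt_abs.1 (show η < |_| from hω) with h | h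
    · exact Or.inl h.le
    · refine Or.inr ?_
      simp only [Set.mem_ofPred_eq, Finset.sum_neg_distrib, neg_div]
      linarith
  · rw [← ENNReal.ofReal_add (Real.exp_pos _).le (Real.exp_pos _).le, two_mul]

namespace DetPOMDP

variable {S : Type*} {O : Type*} [MeasurableSpace O] {A : ℕ} {𝓜 : DetPOMDP S O A} [NeZero A]

/-- Shorter sequences are indexed as prefixes of full ones, so the union bound runs over a finite
type of size H·A^H. -/
theorem eq_take_ofFn {H : ℕ} {l : List (Fin A)} (hl : l.length < H) :
    ∃ g : Fin H → Fin A, l = (List.ofFn g).take l.length := by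
  refine ⟨fun i => l.getD i 0, List.ext_getElem (by simp; omega) fun n h1 h2 => ?_⟩
  simp [h1]

/-- With high probability all empirical means are accurate. -/
theorem tapeLaw_not_accurate_le {H d : ℕ} {Θ Δ : ℝ} {ψ : O → EuclideanSpace ℝ (Fin d)}
    (hψ : Measurable ψ) (hψ1 : ∀ o, ‖ψ o‖ ≤ 1)
    {𝓛 : SeqModel H A d Θ Δ} (hd : 𝓜.Describes ψ 𝓛) {M n : ℕ} (hM : 0 < M) {η : ℝ} (hη : 0 ≤ η) :
    𝓜.tapeLaw {ω | ¬ Accurate 𝓛 (𝓜.env ψ ω) M n η} ≤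
      ENNReal.ofReal ((n * (H * (A ^ H * (d + A)))) * (2 * Real.exp (-(M * (η ^ 2 / 2))))) := by
  set b : ℝ := 2 * Real.exp (-(M * (η ^ 2 / 2))) with hb
  -- One bad event for each start of a window, prefix length, full action sequence, and feature
  -- coordinate or final action. For fixed indices the samples are independent, so adaptivity plays
  -- no role.
  set B : Fin n × Fin H × (Fin H → Fin A) × (Fin d ⊕ Fin A) → Set (Tape S O A) := fun z =>
    let l := (List.ofFn z.2.2.1).take z.2.1
    match z.2.2.2 with
    | .inl i => {ω | η < |(∑ j ∈ Finset.range M, (𝓜.env ψ ω).feat (z.1 + 1 + j) l i) / M - 𝓛.μ l i|}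
    | .inr a => {ω | η < |(∑ j ∈ Finset.range M, (𝓜.env ψ ω).rew (z.1 + 1 + j) l a) / M - 𝓛.r l a|}
    with hB
  have hBle : ∀ z, 𝓜.tapeLaw (B z) ≤ ENNReal.ofReal b := by
    rintro ⟨e, h, g, i | a⟩
    · set l := (List.ofFn g).take h with hl
      have h1 := hoeffding_abs (fun i : ℕ × ℕ × S => 𝓜.emission i.2.1 i.2.2)
        (fun _ o => (ψ o) i) (fun _ => by fun_prop) (M := M)
        (f := fun j => ((e : ℕ) + 1 + j, l.length, 𝓜.latent l))
        (fun j j' hj => by simpa using hj)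
        (fun j => Filter.Eventually.of_forall fun o => abs_le.1
          ((PiLp.norm_apply_le (ψ o) i).trans (hψ1 o))) (μ := 𝓛.μ l i)
        (fun j => by
          rw [hd.μ_eq]
          have hint : Integrable ψ (𝓜.emission l.length (𝓜.latent l)) :=
            Integrable.of_bound hψ.aestronglyMeasurable 1 (Filter.Eventually.of_forall hψ1)
          exact ContinuousLinearMap.integral_comp_comm
            (EuclideanSpace.proj i : EuclideanSpace ℝ (Fin d) →L[ℝ] ℝ) hint) hM hη
      refine le_trans (le_of_eq ?_) h1
      have h2 : B (e, h, g, .inl i) = {ω : ℕ × ℕ × S → O | η < |(∑ j ∈ Finset.range M,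
        (ψ (ω ((e : ℕ) + 1 + j, l.length, 𝓜.latent l))) i) / M - 𝓛.μ l i|} ×ˢ Set.univ := by
        ext ω
        simp [hB, env, hl]
      rw [h2, tapeLaw, Measure.prod_prod, measure_univ, mul_one]
    · set l := (List.ofFn g).take h with hl
      have h1 := hoeffding_abs (fun i : ℕ × ℕ × S × Fin A => 𝓜.reward i.2.1 i.2.2.1 i.2.2.2)
        (fun _ x => x) (fun _ => measurable_id) (M := M)
        (f := fun j => ((e : ℕ) + 1 + j, l.length, 𝓜.latent l, a))
        (fun j j' hj => by simpa using hj)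
        (fun j => by
          filter_upwards [𝓜.reward_mem l.length (𝓜.latent l) a] with x hx
          exact ⟨by linarith [hx.1], hx.2⟩) (μ := 𝓛.r l a)
        (fun j => (hd.r_eq l a).symm) hM hη
      refine le_trans (le_of_eq ?_) h1
      have h2 : B (e, h, g, .inr a) = Set.univ ×ˢ {ω : ℕ × ℕ × S × Fin A → ℝ |
        η < |(∑ j ∈ Finset.range M,
        ω ((e : ℕ) + 1 + j, l.length, 𝓜.latent l, a)) / M - 𝓛.r l a|} := by
        ext ω
        simp [hB, env, hl]
      rw [h2, tapeLaw, Measure.prod_prod, measure_univ, one_mul]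
  have hsub : {ω | ¬ Accurate 𝓛 (𝓜.env ψ ω) M n η} ⊆ ⋃ z, B z := by
    intro ω hω
    by_contra hnot
    simp only [Set.mem_iUnion, not_exists] at hnot
    refine hω fun e he l hl => ?_
    obtain ⟨g, hg⟩ := eq_take_ofFn hl
    constructor
    · intro i
      -- A window start satisfies e < n because e + M ≤ n and M > 0.
      have := hnot (⟨e, by omega⟩, ⟨l.length, hl⟩, g, .inl i)
      simp only [hB, Set.mem_ofPred_eq, not_lt, ← hg] at this
      exact this
    · intro a
      have := hnot (⟨e, by omega⟩, ⟨l.length, hl⟩, g, .inr a)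
      simp only [hB, Set.mem_ofPred_eq, not_lt, ← hg] at this
      exact this
  refine (measure_mono hsub).trans ((measure_iUnion_fintype_le _ _).trans
    ((Finset.sum_le_sum fun z _ => hBle z).trans (le_of_eq ?_)))
  have hcard : Fintype.card (Fin n × Fin H × (Fin H → Fin A) × (Fin d ⊕ Fin A)) =
      n * (H * (A ^ H * (d + A))) := by simp
  clear_value b
  rw [Finset.sum_const, Finset.card_univ, hcard, nsmul_eq_mul, ← ENNReal.ofReal_natCast,
    ← ENNReal.ofReal_mul (by positivity)]
  push_cast
  rfl

end DetPOMDP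

/-! ### Polynomial cost bounds and the number of samples. -/

section CostPolynomial

variable {R : Type*} [CommSemiring R]

/-! Polynomial bounds for the costs, per sample. -/

def sampleBase (H d : R) : R := H * (d + 2) + 2 * d + 4 + d + 1

def coverBase (d N : R) : R :=
  d * (d * 1) + N * (d * (d * 5) + d * 2 + 1) + (d * (d * 2) + (d * 2 + (1 + 1)))

def greedyBase (A d N : R) : R :=
  A * (d * (d * 1) + N * (d * (d * 5) + d * 2 + 1) + (N * (d * 2) + (d * (d * 2) + d * 2))) + A

def nodeBase (H A d N : R) : R :=
  2 * sampleBase H d + coverBase d N + greedyBase A d N + A * sampleBase H d + A + 1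

def pointBase (H A d N : R) : R := A * (sampleBase H d + nodeBase H A d N * H + 1)

def roundBase (H A d N : R) : R :=
  H * (sampleBase H d + greedyBase A d N) + H * coverBase d N

def totalBase (H A d N : R) : R :=
  roundBase H A d N + (pointBase H A d N + roundBase H A d N) * (H * N)

/-- The bound for the size of the datasets. -/
def sizeBound (d Θ D : R) : R := 2 * d * (1 + 8 * Θ * D) ^ 4

/-- The inverse of the accuracy of the empirical means. -/
def invAccuracy (H d Θ D : R) : R := 8 * D * (sizeBound d Θ D + 1) * (H + d * Θ)

/-- A polynomial that bounds the logarithm of the number of empirical means. -/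
def logBound (H d Θ D A : R) : R :=
  8 * invAccuracy H d Θ D ^ 2 * totalBase H A d (sizeBound d Θ D) * (H * (d + A))

/-- The number of samples, before rounding. -/
def sampleSize (H d Θ L D A : R) : R :=
  4 * invAccuracy H d Θ D ^ 2 * (L + H * A + logBound H d Θ D A)

/-- The polynomial that bounds the total cost. -/
def costBound (H d Θ L D A : R) : R :=
  totalBase H A d (sizeBound d Θ D) * (sampleSize H d Θ L D A + 2)

/-- The bounds are defined over any commutative semiring, so one expression serves both as
polynomial and as its real value. -/
theorem eval_costBound (x : Fin 6 → ℝ) :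
    MvPolynomial.eval x (costBound (MvPolynomial.X 0) (MvPolynomial.X 1) (MvPolynomial.X 2)
      (MvPolynomial.X 3) (MvPolynomial.X 4) (MvPolynomial.X 5)) =
      costBound (x 0) (x 1) (x 2) (x 3) (x 4) (x 5) := by
  simp [costBound, sampleSize, logBound, invAccuracy, sizeBound, totalBase, roundBase, pointBase,
    nodeBase, greedyBase, coverBase, sampleBase]

end CostPolynomial

/-- Terms without a factor M are multiplied by M ≥ 1. A bound linear in M, with a coefficient free
of M, avoids circularity in the choice of M. -/
theorem totalCost_le {H A d M N : ℕ} {N' : ℝ} (hM : 1 ≤ M) (hN : (N : ℝ) ≤ N') :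
    (totalCost H A d M N : ℝ) ≤ totalBase (H : ℝ) A d N' * M := by
  have hM' : (1 : ℝ) ≤ M := by exact_mod_cast hM
  have hN0 : 0 ≤ N' := (Nat.cast_nonneg N).trans hN
  have up : ∀ x : ℝ, 0 ≤ x → x ≤ x * M := fun x hx => le_mul_of_one_le_right hx hM'
  have hs : (sampleCost H d M : ℝ) ≤ sampleBase (H : ℝ) d * M := by
    unfold sampleCost sampleBase
    push_cast
    linarith [up d (by positivity)]
  have hc : (coverCost d N : ℝ) ≤ coverBase (d : ℝ) N' * M := by
    refine le_trans ?_ (up _ (by unfold coverBase; positivity))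
    unfold coverCost coverBase
    push_cast
    rw [one_add_one_eq_two]
    gcongr
  have hg : (greedyCost A d N : ℝ) ≤ greedyBase (A : ℝ) d N' * M := by
    refine le_trans ?_ (up _ (by unfold greedyBase; positivity))
    unfold greedyCost greedyBase
    push_cast
    gcongr
  have hn : (nodeCost H A d M N : ℝ) ≤ nodeBase (H : ℝ) A d N' * M := by
    unfold nodeCost nodeBase
    push_cast
    have := mul_le_mul_of_nonneg_left hs (Nat.cast_nonneg (α := ℝ) A)
    linarith [up A (by positivity)]
  have hp : (pointCost H A d M N : ℝ) ≤ pointBase (H : ℝ) A d N' * M := by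
    unfold pointCost pointBase
    push_cast
    have := mul_le_mul_of_nonneg_right hn (Nat.cast_nonneg (α := ℝ) H)
    rw [mul_assoc]
    refine mul_le_mul_of_nonneg_left ?_ (Nat.cast_nonneg _)
    linarith
  have hr : (roundCost H A d M N : ℝ) ≤ roundBase (H : ℝ) A d N' * M := by
    unfold roundCost roundBase
    push_cast
    rw [add_mul, mul_assoc, mul_assoc]
    refine add_le_add (mul_le_mul_of_nonneg_left ?_ (Nat.cast_nonneg _))
      (mul_le_mul_of_nonneg_left hc (Nat.cast_nonneg _))
    linarith
  unfold totalCost totalBase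
  push_cast
  have h1 : ((pointCost H A d M N : ℝ) + roundCost H A d M N) * (H * N) ≤
      ((pointBase (H : ℝ) A d N' + roundBase (H : ℝ) A d N') * M) * (H * N') := by
    refine mul_le_mul (by linarith) (by gcongr) (by positivity) ?_
    have := (Nat.cast_nonneg (α := ℝ) (pointCost H A d M N)).trans hp
    have := (Nat.cast_nonneg (α := ℝ) (roundCost H A d M N)).trans hr
    linarith
  linarith

theorem totalBase_nonneg {H A d N : ℝ} (hH : 0 ≤ H) (hA : 0 ≤ A) (hd : 0 ≤ d) (hN : 0 ≤ N) :
    0 ≤ totalBase H A d N := by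
  unfold totalBase roundBase pointBase nodeBase greedyBase coverBase sampleBase
  positivity

/-- The failure probability for the chosen number of samples. -/
theorem failure_le {M H A : ℕ} {c δ K B T D : ℝ} (hc : 0 < c) (hδ : 0 < δ)
    (hB : 0 ≤ B) (hD : 0 ≤ D) (hT : T ≤ B * M)
    (hK : K = 4 / c * B * (H * D))
    (hM : 2 / c * (Real.log (1 / δ) + H * A + K) ≤ M) :
    T * (H * (A ^ H * D)) * (2 * Real.exp (-(M * c))) ≤ δ := by
  have hK0 : 0 ≤ K := by rw [hK]; positivity
  have h1 : Real.log (1 / δ) + H * A + K ≤ M * c / 2 := by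
    have := mul_le_mul_of_nonneg_left hM (show 0 ≤ c / 2 by positivity)
    calc _ = c / 2 * (2 / c * (Real.log (1 / δ) + H * A + K)) := by field_simp
      _ ≤ c / 2 * M := this
      _ = _ := by ring
  -- One half of the exponent gives δ, a factor against A^H, and a factor against the remaining
  -- constant K; the other half absorbs the factor M from T ≤ BM, by t·e⁻ᵗ ≤ 1.
  have h2 : Real.exp (-(M * c / 2)) ≤ δ * Real.exp (-(H * A)) * Real.exp (-K) := by
    have : δ = Real.exp (-Real.log (1 / δ)) := by
      rw [Real.log_div one_ne_zero hδ.ne', Real.log_one, zero_sub, neg_neg, Real.exp_log hδ]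
    rw [this, ← Real.exp_add, ← Real.exp_add]
    exact Real.exp_le_exp.2 (by linarith)
  have h3 : M * Real.exp (-(M * c)) ≤ 2 / c * Real.exp (-(M * c / 2)) := by
    have h4 : M * c / 2 ≤ Real.exp (M * c / 2) := by
      linarith [Real.add_one_le_exp (M * c / 2)]
    have h5 : Real.exp (-(M * c)) = Real.exp (-(M * c / 2)) * Real.exp (-(M * c / 2)) := by
      rw [← Real.exp_add]; ring_nf
    have h6 : Real.exp (M * c / 2) * Real.exp (-(M * c / 2)) = 1 := by
      rw [← Real.exp_add]; simp
    have h7 : M * c / 2 * Real.exp (-(M * c / 2)) ≤ 1 := by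
      rw [← h6]; gcongr
    calc M * Real.exp (-(M * c)) =
        2 / c * Real.exp (-(M * c / 2)) * (M * c / 2 * Real.exp (-(M * c / 2))) := by
          rw [h5]; field_simp
      _ ≤ 2 / c * Real.exp (-(M * c / 2)) * 1 := by gcongr
      _ = _ := mul_one _
  have h8 : (A : ℝ) ^ H * Real.exp (-(H * A)) ≤ 1 := by
    have h9 : (A : ℝ) ^ H ≤ Real.exp (H * A) := by
      rw [Real.exp_nat_mul]
      gcongr
      linarith [Real.add_one_le_exp (A : ℝ)]
    calc _ ≤ Real.exp (H * A) * Real.exp (-(H * A)) := by gcongr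
      _ = 1 := by rw [← Real.exp_add]; simp
  have h10 : K * Real.exp (-K) ≤ 1 := by
    calc _ ≤ Real.exp K * Real.exp (-K) := by
          gcongr; linarith [Real.add_one_le_exp K]
      _ = 1 := by rw [← Real.exp_add]; simp
  have hA : (0 : ℝ) ≤ (A : ℝ) ^ H := by positivity
  calc T * (H * (A ^ H * D)) * (2 * Real.exp (-(M * c)))
      ≤ (B * M) * (H * (A ^ H * D)) * (2 * Real.exp (-(M * c))) := by gcongr
    _ = 2 * B * (H * D) * A ^ H * (M * Real.exp (-(M * c))) := by ring
    _ ≤ 2 * B * (H * D) * A ^ H * (2 / c * Real.exp (-(M * c / 2))) := by gcongr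
    _ = K * A ^ H * Real.exp (-(M * c / 2)) := by rw [hK]; field_simp; ring
    _ ≤ K * A ^ H * (δ * Real.exp (-(H * A)) * Real.exp (-K)) := by gcongr
    _ = δ * (A ^ H * Real.exp (-(H * A))) * (K * Real.exp (-K)) := by ring
    _ ≤ δ * 1 * 1 := by gcongr
    _ = δ := by ring

end EQDP

/-! ### Choice of the parameters and conclusion. -/

theorem mainTheorem6 :
    ∃ poly : MvPolynomial (Fin 6) ℝ,
      ∀ (H d A : ℕ) [NeZero A] (Θ δ Δ : ℝ), 0 < H → 0 < δ → δ < 1 → 0 < Δ →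
      ∃ p : EQDP.Params, 0 < p.M ∧ 0 < p.ε ∧ 0 < p.lam ∧
      ∀ (S : Type*) (O : Type*) [MeasurableSpace O] (𝓜 : EQDP.DetPOMDP S O A) (dₛ : ℕ)
        (ψ : O → EuclideanSpace ℝ (Fin d)) (φ : S → EuclideanSpace ℝ (Fin dₛ))
        (G : Fin H → Matrix (Fin d) (Fin dₛ) ℝ) (W : ℝ),
        0 < dₛ → Measurable ψ → (∀ o, ‖ψ o‖ ≤ 1) →
        𝓜.IsMeanEmbedding H ψ φ G → 𝓜.LinearQstar H φ W → 𝓜.HasGap H Δ →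
        Θ = W / (⨅ h : Fin H, EQDP.minSingularValue (G h)) →
        (∀ ω : EQDP.Tape S O A, ∃ (l : List (Fin A)) (c : ℕ),
          EQDP.Terminates (𝓜.env ψ ω) p H l c ∧
          (c : ℝ) ≤ MvPolynomial.eval
            ![(H : ℝ), (d : ℝ), Θ, Real.log (1 / δ), 1 / Δ, (A : ℝ)] poly) ∧
        𝓜.tapeLaw {ω | ¬ ∃ (l : List (Fin A)) (c : ℕ),
          EQDP.Terminates (𝓜.env ψ ω) p H l c ∧ 𝓜.IsOptimalSeq H l} ≤ ENNReal.ofReal δ := by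
  open EQDP in
  refine ⟨costBound (MvPolynomial.X 0) (MvPolynomial.X 1) (MvPolynomial.X 2)
      (MvPolynomial.X 3) (MvPolynomial.X 4) (MvPolynomial.X 5), ?_⟩
  intro H d A _ Θ δ Δ hH hδ hδ1 hΔ
  by_cases hpos : 0 ≤ Θ ∧ 0 < d
  swap
  -- No model realizes such Θ and d, so any parameters will do.
  · refine ⟨⟨1, 1, 1⟩, one_pos, one_pos, one_pos, ?_⟩
    intro S O _ 𝓜 dₛ ψ φ G W hdₛ _ _ hG hQ hgap hΘ
    have := DetPOMDP.exists_describes hH hdₛ hG hQ hgap hΘ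
    exact absurd ⟨this.1, this.2.1⟩ hpos
  obtain ⟨hΘ0, hd⟩ := hpos
  set D : ℝ := 1 / Δ with hD
  have hD0 : 0 < D := by positivity
  have hDΔ : D * Δ = 1 := by rw [hD]; field_simp
  have hH1 : (1 : ℝ) ≤ H := by exact_mod_cast hH
  set L : ℝ := Real.log (1 / δ) with hL
  set a : ℝ := 1 + 8 * Θ * D with ha
  have ha1 : 1 ≤ a := by rw [ha]; linarith [show 0 ≤ 8 * Θ * D by positivity]
  have ha0 : 0 < a := by linarith
  set N' : ℝ := sizeBound (d : ℝ) Θ D with hN'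
  have hN'0 : 0 ≤ N' := by rw [hN']; unfold sizeBound; positivity
  set g : ℝ := invAccuracy (H : ℝ) d Θ D with hg
  have hHd : 0 < (H : ℝ) + d * Θ := by positivity
  have hgeq : g = 8 * D * (N' + 1) * (H + d * Θ) := rfl
  have hg0 : 0 < g := by rw [hgeq]; positivity
  -- The 1 makes M positive; with the rounding it accounts for the 2 in `costBound`.
  set M : ℕ := ⌈sampleSize (H : ℝ) d Θ L D A⌉₊ + 1 with hM
  set N : ℕ := ⌊N'⌋₊ with hN
  have hNN' : (N : ℝ) ≤ N' := Nat.floor_le hN'0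
  have hM1 : 1 ≤ M := Nat.le_add_left _ _
  set B : ℝ := totalBase (H : ℝ) A d N' with hB
  have hB0 : 0 ≤ B :=
    totalBase_nonneg (Nat.cast_nonneg _) (Nat.cast_nonneg _) (Nat.cast_nonneg _) hN'0
  have hT : (totalCost H A d M N : ℝ) ≤ B * M := totalCost_le hM1 hNN'
  have hL0 : 0 ≤ L := Real.log_nonneg (by rw [le_div_iff₀ hδ]; linarith)
  have hK0 : 0 ≤ logBound (H : ℝ) d Θ D A := by
    change 0 ≤ 8 * g ^ 2 * B * (H * (d + A))
    positivity
  have hSS0 : 0 ≤ sampleSize (H : ℝ) d Θ L D A := by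
    change 0 ≤ 4 * g ^ 2 * (L + H * A + logBound (H : ℝ) d Θ D A)
    positivity
  have hMle : (M : ℝ) ≤ sampleSize (H : ℝ) d Θ L D A + 2 := by
    rw [hM]; push_cast
    linarith [Nat.ceil_lt_add_one hSS0]
  have hMge : sampleSize (H : ℝ) d Θ L D A ≤ M := by
    rw [hM]; push_cast
    linarith [Nat.le_ceil (sampleSize (H : ℝ) d Θ L D A)]
  have hcost : (totalCost H A d M N : ℝ) ≤ costBound (H : ℝ) d Θ L D A :=
    hT.trans (mul_le_mul_of_nonneg_left hMle hB0)
  refine ⟨⟨M, 1 / a, 1⟩, hM1, by positivity, one_pos, ?_⟩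
  intro S O _ 𝓜 dₛ ψ φ G W hdₛ hψ hψ1 hG hQ hgap hΘ
  obtain ⟨-, -, 𝓛, hdesc⟩ := DetPOMDP.exists_describes hH hdₛ hG hQ hgap hΘ
  have hregime : ∀ (ω : Tape S O A) (n : ℕ), Accurate 𝓛 (𝓜.env ψ ω) M n (1 / g) →
      Regime 𝓛 (𝓜.env ψ ω) ⟨M, 1 / a, 1⟩ N n (1 / g) := by
    intro ω n hacc
    refine ⟨rfl, hM1, by positivity, (div_le_one ha0).2 ha1, fun k hk => ?_, hΘ0, by positivity,
      ?_, fun i l => ?_, hacc⟩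
    · refine Nat.le_floor ?_
      have h1 : (k : ℝ) * ((1 / a) ^ 4 / 2) * (2 * a ^ 4) ≤ d * (2 * a ^ 4) := by gcongr
      have h2 : (k : ℝ) * ((1 / a) ^ 4 / 2) * (2 * a ^ 4) = k := by field_simp
      rw [h2] at h1
      rw [hN']
      unfold sizeBound
      linarith
    -- With ε = 1/a the bias is at most Δ/8. With η = 1/g the noise and the feature error together
    -- are at most (N' + 1)(H + dΘ)η = Δ/8. The total Δ/4 is below Δ/2.
    · have h1 : 1 / a * Θ ≤ Δ / 8 := by
        rw [one_div_mul_eq_div, div_le_iff₀ ha0, ha]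
        have : Δ / 8 * (1 + 8 * Θ * D) = Δ / 8 + Θ * (D * Δ) := by ring
        rw [this, hDΔ]
        linarith
      have h2 : (H + d * Θ) * (1 / g) * (N' + 1) = Δ / 8 := by
        rw [hgeq, hD]; field_simp
      have h3 : 0 ≤ (H + d * Θ) * (1 / g) := by positivity
      have h4 : (N : ℝ) * (targetError H d Θ (1 / g) * (1 / a)) ≤ N' * ((H + d * Θ) * (1 / g)) := by
        unfold targetError
        have : (1 / a) ≤ 1 := (div_le_one ha0).2 ha1
        have : (H + d * Θ) * (1 / g) * (1 / a) ≤ (H + d * Θ) * (1 / g) :=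
          mul_le_of_le_one_right h3 this
        gcongr
      have h5 : d * Θ * (1 / g) ≤ (H + d * Θ) * (1 / g) := by
        gcongr; linarith
      simp only
      linarith
    · have h1 : (ψ (ω.1 (i, l.length, 𝓜.latent l))).ofLp ⬝ᵥ
          (ψ (ω.1 (i, l.length, 𝓜.latent l))).ofLp =
          ‖ψ (ω.1 (i, l.length, 𝓜.latent l))‖ ^ 2 := by
        rw [EuclideanSpace.norm_sq_eq]
        simp [dotProduct, pow_two]
      exact h1.le.trans <| pow_le_one₀ (norm_nonneg _) (hψ1 _)
  constructor
  · intro ω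
    -- With no episodes allowed, accuracy is vacuous, so termination and the cost bound hold for
    -- every tape.
    have hacc : Accurate 𝓛 (𝓜.env ψ ω) M 0 (1 / g) := fun e he => by omega
    obtain ⟨l, c, hterm, hc, -⟩ := (hregime ω 0 hacc).terminates
    refine ⟨l, c, hterm, ?_⟩
    rw [eval_costBound]
    exact (Nat.cast_le.2 hc).trans hcost
  -- Accuracy up to episode `totalCost` suffices, since the run uses no more episodes than
  -- operations.
  · refine (measure_mono (t := {ω | ¬ Accurate 𝓛 (𝓜.env ψ ω) M (totalCost H A d M N) (1 / g)})
      ?_).trans ((DetPOMDP.tapeLaw_not_accurate_le hψ hψ1 hdesc hM1 (by positivity)).trans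
        (ENNReal.ofReal_le_ofReal ?_))
    · intro ω hω hacc
      obtain ⟨l, c, hterm, -, hopt⟩ := (hregime ω _ hacc).terminates
      exact hω ⟨l, c, hterm, DetPOMDP.isOptimalSeq hdesc (hopt le_rfl).1 (hopt le_rfl).2⟩
    · refine failure_le (c := (1 / g) ^ 2 / 2) (B := B) (K := logBound (H : ℝ) d Θ D A)
        (by positivity) hδ hB0 (by positivity) hT ?_ ?_
      · change 8 * g ^ 2 * B * (H * (d + A)) = _
        field_simp
        ring
      · refine le_trans (le_of_eq ?_) hMge
        change _ = 4 * g ^ 2 * (L + H * A + logBound (H : ℝ) d Θ D A)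
        field_simp
        ring
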